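/- Let $\Theta$ and $A$ be finite sets, $\pi\in\Delta(\Theta)$ a prior with full support, $u:A\times\Theta\to\mathbb R$, $\kappa>0$ and $\alpha\in\mathbb R$. A stochastic choice rule is a family $P=(P_\theta)_{\theta\in\Theta}$ with $P_\theta\in\Delta(A)$. For $p,q\in\Delta(A)$ let $D_\alpha[p:q]=\frac{4}{1-\alpha^2}\bigl(1-\sum_a p(a)^{(1-\alpha)/2}q(a)^{(1+\alpha)/2}\bigr)$ if $\alpha\ne\pm1$, $D_{-1}[p:q]=\sum_a p(a)\log\frac{p(a)}{q(a)}$, $D_1[p:q]=\sum_a q(a)\log\frac{q(a)}{p(a)}$, with values in $[0,+\infty]$ and the conventions $0\cdot(\pm\infty)=0$, $1/0=+\infty$, $\log 0=-\infty$, $\log(+\infty)=+\infty$. Let $I_\alpha(P)=\min_{m\in\Delta(A)}\sum_\theta\pi(\theta)D_\alpha[P_\theta:m]$. The rule $P$ is called optimal if it maximizes $\sum_\theta\pi(\theta)\sum_a P_\theta(a)u(a,\theta)-\kappa I_\alpha(P)$ over all stochastic choice rules. Put $h_\alpha[t]=t^{(1-\alpha)/2}$ for $\alpha\neq1$, $h_1[t]=\log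 t$, and $M_\alpha[x]=h_\alpha^{-1}\bigl[\sum_\theta\pi(\theta)h_\alpha[x_\theta]\bigr]$. Let $T$ be $\bigcup_\theta\operatorname{supp}P_\theta$ if $\alpha<1$ and $\bigcap_\theta\operatorname{supp}P_\theta$ if $\alpha\ge1$. If $\alpha<1$, or $\alpha\ge 1$ and $T\neq\emptyset$, the $\alpha$-integration of $P$ is said to exist and is the distribution with $m_\alpha^P(a)=M_\alpha[(P_\theta(a))_\theta]/\sum_{b\in T}M_\alpha[(P_\theta(b))_\theta]$ for $a\in T$ and $m_\alpha^P(a)=0$ otherwise. Put $q_\alpha=(3+\alpha)/2$, $\exp_q(x)=[1+(1-q)x]_+^{1/(1-q)}$ for $q\ne1$ and $\exp_1=\exp$ (so for $q>1$ the value is $+\infty$ where the bracket vanishes). For $m\in\Delta(A)$ with support $S_m$ and $\theta\in\Theta$ let $\bar\lambda_{\theta m}$ be the unique real solution $\lambda$ of $\sum_{a\in S_m}m(a)\exp_{q_\alpha}\bigl((u(a,\theta)-\lambda)/\kappa\bigr)=1$, and, if $\alpha>-1$ and $S_m\ne A$, let $\bar\lambda^0_{\theta m}=\max_{a\notin S_m}u(a,\theta)-\frac{2\kappa}{1+\alpha}$.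 Put $\lambda_\theta(m)=\bar\lambda_{\theta m}$ if $\alpha\le-1$ or $S_m=A$, and $\lambda_\theta(m)=\max\{\bar\lambda_{\theta m},\bar\lambda^0_{\theta m}\}$ otherwise. Then a stochastic choice rule $P$ is optimal if and only if its $\alpha$-integration $m=m_\alpha^P$ exists and, with $\lambda_\theta=\lambda_\theta(m)$, the following two conditions hold. 1. For each $\theta$, $P_\theta$ solves $\max_{p\in\Delta(A)}\sum_a p(a)u(a,\theta)-\kappa D_\alpha[p:m]$. 2. Every $a\in\operatorname{supp}m$ maximizes (if $\alpha\le1$), respectively minimizes (if $\alpha>1$), over all actions in $A$, the value $\sum_\theta\pi(\theta)h_\alpha\bigl[\exp_{q_\alpha}\bigl((u(a,\theta)-\lambda_\theta)/\kappa\bigr)\bigr]\in(-\infty,+\infty]$. Moreover, if $m=m_\alpha^P$ exists, then for each $\theta$ a distribution $p\in\Delta(A)$ solves the problem in condition 1 if and only if: in the cases $\alpha\le-1$, $S_m=A$, or $\bar\lambda^0_{\theta m}\le\bar\lambda_{\theta m}$, one has $p(a)=m(a)\exp_{q_\alpha}((u(a,\theta)-\bar\lambda_{\theta m})/\kappa)$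 for all $a\in A$; in the remaining case $\bar\lambda_{\theta m}<\bar\lambda^0_{\theta m}$, one has $p(a)=m(a)\exp_{q_\alpha}((u(a,\theta)-\bar\lambda^0_{\theta m})/\kappa)$ for $a\in S_m$ and $p(a)=0$ for every $a\notin S_m$ with $u(a,\theta)<\max_{b\notin S_m}u(b,\theta)$. For $\alpha=-1$, writing $r(a)=\sum_\theta\pi(\theta)P_\theta(a)$, the rule $P$ is optimal if and only if $P_\theta(a)=\dfrac{r(a)e^{u(a,\theta)/\kappa}}{\sum_b r(b)e^{u(b,\theta)/\kappa}}$ for all $\theta,a$, and $\sum_\theta\pi(\theta)\dfrac{e^{u(a,\theta)/\kappa}}{\sum_b r(b)e^{u(b,\theta)/\kappa}}\le1$ for all $a\in A$. -/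

import Mathlib

noncomputable section

namespace AlphaInfo

open scoped ENNReal

/-- The exponent parameter `q_α = (3 + α) / 2`. -/
def qOf (α : ℝ) : ℝ := (3 + α) / 2

/-- The `q`-exponential `[1 + (1 - q) x]_+ ^ (1 / (1 - q))` (and `exp` for `q = 1`), with values
in `[0, ∞]`: for `q > 1` it is `∞` where the bracket vanishes (`1 / 0 = ∞`). -/
def expQ (q x : ℝ) : ℝ≥0∞ :=
  if q = 1 then ENNReal.ofReal (Real.exp x)
  else ENNReal.ofReal (1 + (1 - q) * x) ^ (1 / (1 - q))

/-- `h_α[t] = t ^ ((1 - α) / 2)` for `α ≠ 1` and `h_1[t] = log t`, on `[0, ∞]`. -/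
def h (α : ℝ) (t : ℝ≥0∞) : EReal :=
  if α = 1 then ENNReal.log t else ((t ^ ((1 - α) / 2) : ℝ≥0∞) : EReal)

/-- The inverse of `h_α`. -/
def hInv (α : ℝ) (y : EReal) : ℝ≥0∞ :=
  if α = 1 then EReal.exp y else y.toENNReal ^ (2 / (1 - α))

theorem hInv_h (α : ℝ) (t : ℝ≥0∞) : hInv α (h α t) = t := by
  unfold hInv h
  split_ifs with hα
  · simp
  · have h1 : 1 - α ≠ 0 := sub_ne_zero.mpr (Ne.symm hα)
    have h2 : (1 - α) / 2 * (2 / (1 - α)) = 1 := by field_simp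
    rw [EReal.toENNReal_coe, ← ENNReal.rpow_mul, h2, ENNReal.rpow_one]

section Divergence

variable {A : Type*} [Fintype A]

/-- The `α`-divergence `D_α[p : q]`, with values in the extended reals.  The conventions
`0 * ∞ = 0`, `1 / 0 = ∞`, `log 0 = -∞` are those of `ℝ≥0∞` and `EReal`. -/
def alphaDiv (α : ℝ) (p q : A → ℝ) : EReal :=
  if α = -1 then
    ∑ a, (p a : EReal) * ENNReal.log (ENNReal.ofReal (p a) / ENNReal.ofReal (q a))
  else if α = 1 then
    ∑ a, (q a : EReal) * ENNReal.log (ENNReal.ofReal (q a) / ENNReal.ofReal (p a))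
  else
    ((4 / (1 - α ^ 2) : ℝ) : EReal) *
      (1 - ((∑ a, ENNReal.ofReal (p a) ^ ((1 - α) / 2) *
        ENNReal.ofReal (q a) ^ ((1 + α) / 2) : ℝ≥0∞) : EReal))

/-- Objective of the problem at a given state, with payoffs `v a = u(a, θ)`. -/
def stateObjective (α κ : ℝ) (v m p : A → ℝ) : EReal :=
  ((∑ a, p a * v a : ℝ) : EReal) - (κ : EReal) * alphaDiv α p m

/-- `p` solves `max_{p ∈ Δ(A)} ∑ a, p a * v a - κ * D_α[p : m]`. -/
def IsStateSolution (α κ : ℝ) (v m p : A → ℝ) : Prop :=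
  p ∈ stdSimplex ℝ A ∧
    ∀ p' ∈ stdSimplex ℝ A, stateObjective α κ v m p' ≤ stateObjective α κ v m p

/-- The left side of the normalization equation that determines the constant
(terms with `m a = 0` vanish, so this is the sum over the support of `m`). -/
def normSum (α κ : ℝ) (v m : A → ℝ) (l : ℝ) : ℝ≥0∞ :=
  ∑ a, ENNReal.ofReal (m a) * expQ (qOf α) ((v a - l) / κ)

/-- The unique real `l` with `normSum α κ v m l = 1`; see `existsUnique_normSum_eq_one`. -/
def lamBar (α κ : ℝ) (v m : A → ℝ) : ℝ :=
  Classical.epsilon fun l : ℝ => normSum α κ v m l = 1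

/-- `max_{a ∉ supp m} v a` (used only if some action lies outside the support). -/
def outsideMax (v m : A → ℝ) : ℝ := ⨆ a : {a : A // a ∉ Function.support m}, v a

/-- `max_{a ∉ supp m} v a - 2 κ / (1 + α)`. -/
def lamZero (α κ : ℝ) (v m : A → ℝ) : ℝ := outsideMax v m - 2 * κ / (1 + α)

open Classical in
/-- The constant `λ_θ` attached to the problem at a state with payoffs `v`. -/
def stateConstant (α κ : ℝ) (v m : A → ℝ) : ℝ :=
  if α ≤ -1 ∨ Function.support m = Set.univ then lamBar α κ v m
  else if lamZero α κ v m ≤ lamBar α κ v m then lamBar α κ v m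
  else lamZero α κ v m

open Classical in
/-- The explicit form of the solutions at a state: the `q`-exponential family relative to `m`,
except that, when `α > -1`, some action lies outside the support of `m` and
`lamBar < lamZero`, the mass left over by the support goes to the best actions outside it. -/
def IsQExponential (α κ : ℝ) (v m p : A → ℝ) : Prop :=
  if (α ≤ -1 ∨ Function.support m = Set.univ) ∨ lamZero α κ v m ≤ lamBar α κ v m then
    ∀ a, ENNReal.ofReal (p a) =
      ENNReal.ofReal (m a) * expQ (qOf α) ((v a - lamBar α κ v m) / κ)
  else
    (∀ a ∈ Function.support m, ENNReal.ofReal (p a) =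
      ENNReal.ofReal (m a) * expQ (qOf α) ((v a - lamZero α κ v m) / κ)) ∧
    ∀ a ∉ Function.support m, v a < outsideMax v m → p a = 0

theorem expQ_mono (q : ℝ) : Monotone (expQ q) := by
  intro x y hxy
  unfold expQ
  split_ifs with hq
  · exact ENNReal.ofReal_le_ofReal (Real.exp_le_exp.mpr hxy)
  · rcases lt_or_gt_of_ne hq with h1 | h1
    · apply ENNReal.rpow_le_rpow _ (by have : 0 < 1 - q := by linarith
                                       positivity)
      apply ENNReal.ofReal_le_ofReal
      nlinarith
    · have h2 : 0 ≤ -(1 / (1 - q)) :=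
        neg_nonneg.mpr (div_nonpos_of_nonneg_of_nonpos zero_le_one (by linarith))
      rw [← neg_neg (1 / (1 - q)), ENNReal.rpow_neg _ (-(1 / (1 - q))),
        ENNReal.rpow_neg _ (-(1 / (1 - q)))]
      apply ENNReal.inv_le_inv.mpr
      apply ENNReal.rpow_le_rpow _ h2
      apply ENNReal.ofReal_le_ofReal
      nlinarith

theorem expQ_zero (q : ℝ) : expQ q 0 = 1 := by
  unfold expQ; split_ifs <;> simp

theorem continuous_expQ (q : ℝ) : Continuous (expQ q) := by
  unfold expQ
  split_ifs with hq
  · exact ENNReal.continuous_ofReal.comp Real.continuous_exp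
  · exact ENNReal.continuous_rpow_const.comp (ENNReal.continuous_ofReal.comp (by fun_prop))

/-- `expQ q` is injective where its value is neither `0` nor `∞`. -/
theorem expQ_inj {q x y : ℝ} (hxy : expQ q x = expQ q y) (h0 : expQ q x ≠ 0)
    (ht : expQ q x ≠ ∞) : x = y := by
  unfold expQ at hxy h0 ht
  split_ifs at hxy h0 ht with hq
  · rw [ENNReal.ofReal_eq_ofReal_iff (Real.exp_pos _).le (Real.exp_pos _).le] at hxy
    exact Real.exp_injective hxy
  · have h1 : 1 - q ≠ 0 := sub_ne_zero.mpr (Ne.symm hq)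
    have h2 : 1 / (1 - q) ≠ 0 := one_div_ne_zero h1
    have h3 := ENNReal.rpow_left_injective h2 hxy
    have h4 : ENNReal.ofReal (1 + (1 - q) * x) ≠ 0 := by
      intro h5
      rw [h5] at h0 ht
      rcases lt_or_gt_of_ne h2 with h6 | h6
      · exact ht (ENNReal.zero_rpow_of_neg h6)
      · exact h0 (ENNReal.zero_rpow_of_pos h6)
    have hx : 0 < 1 + (1 - q) * x := ENNReal.ofReal_pos.mp (pos_iff_ne_zero.mpr h4)
    have hy : 0 < 1 + (1 - q) * y :=
      ENNReal.ofReal_pos.mp (pos_iff_ne_zero.mpr (h3 ▸ h4))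
    rw [ENNReal.ofReal_eq_ofReal_iff hx.le hy.le] at h3
    exact mul_left_cancel₀ h1 (add_left_cancel h3)

theorem existsUnique_normSum_eq_one (α : ℝ) {κ : ℝ} (hκ : 0 < κ) (v : A → ℝ) {m : A → ℝ}
    (hm : m ∈ stdSimplex ℝ A) : ∃! l : ℝ, normSum α κ v m l = 1 := by
  have hsum : ∑ a, ENNReal.ofReal (m a) = 1 := by
    rw [← ENNReal.ofReal_sum_of_nonneg (fun a _ => hm.1 a), hm.2, ENNReal.ofReal_one]
  have hex : ∃ l : ℝ, normSum α κ v m l = 1 := by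
    have hc : Continuous (normSum α κ v m) := by
      unfold normSum
      refine continuous_finsetSum _ fun a _ => ?_
      exact (ENNReal.continuous_const_mul ENNReal.ofReal_ne_top).comp
        ((continuous_expQ _).comp (by fun_prop))
    obtain ⟨B, hB⟩ := (Set.finite_range v).bddAbove
    obtain ⟨b, hb⟩ := (Set.finite_range v).bddBelow
    refine mem_range_of_exists_le_of_exists_ge hc ⟨B, ?_⟩ ⟨b, ?_⟩
    · rw [← hsum]
      refine Finset.sum_le_sum fun a _ => ?_
      have : expQ (qOf α) ((v a - B) / κ) ≤ 1 := by
        rw [← expQ_zero (qOf α)]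
        apply expQ_mono
        have := hB (Set.mem_range_self a)
        exact div_nonpos_of_nonpos_of_nonneg (by linarith) hκ.le
      simpa using mul_le_mul_right this (ENNReal.ofReal (m a))
    · rw [← hsum]
      refine Finset.sum_le_sum fun a _ => ?_
      have : 1 ≤ expQ (qOf α) ((v a - b) / κ) := by
        rw [← expQ_zero (qOf α)]
        apply expQ_mono
        have := hb (Set.mem_range_self a)
        exact div_nonneg (by linarith) hκ.le
      simpa using mul_le_mul_right this (ENNReal.ofReal (m a))
  have key : ∀ l₁ l₂ : ℝ, normSum α κ v m l₁ = 1 → normSum α κ v m l₂ = 1 → l₁ ≤ l₂ →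
      l₁ = l₂ := by
    intro l₁ l₂ h₁ h₂ hle
    have hterm : ∀ a ∈ Finset.univ,
        ENNReal.ofReal (m a) * expQ (qOf α) ((v a - l₂) / κ) ≤
          ENNReal.ofReal (m a) * expQ (qOf α) ((v a - l₁) / κ) := by
      intro a _
      have : expQ (qOf α) ((v a - l₂) / κ) ≤ expQ (qOf α) ((v a - l₁) / κ) := by
        apply expQ_mono
        gcongr
      exact mul_le_mul_right this _
    have hfin : ∀ a, ENNReal.ofReal (m a) * expQ (qOf α) ((v a - l₁) / κ) ≠ ∞ := by
      intro a
      refine ENNReal.sum_ne_top.mp (?_ : normSum α κ v m l₁ ≠ ∞) a (Finset.mem_univ a)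
      rw [h₁]; exact ENNReal.one_ne_top
    have hne : normSum α κ v m l₂ ≠ 0 := by rw [h₂]; exact one_ne_zero
    obtain ⟨a, -, ha⟩ := Finset.exists_ne_zero_of_sum_ne_zero hne
    have heq : ENNReal.ofReal (m a) * expQ (qOf α) ((v a - l₂) / κ) =
        ENNReal.ofReal (m a) * expQ (qOf α) ((v a - l₁) / κ) := by
      by_contra hcon
      have hlt := lt_of_le_of_ne (hterm a (Finset.mem_univ a)) hcon
      have : normSum α κ v m l₂ < normSum α κ v m l₁ := by
        unfold normSum
        classical
        rw [← Finset.add_sum_erase _ _ (Finset.mem_univ a),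
          ← Finset.add_sum_erase Finset.univ
            (fun a => ENNReal.ofReal (m a) * expQ (qOf α) ((v a - l₁) / κ)) (Finset.mem_univ a)]
        refine ENNReal.add_lt_add_of_lt_of_le ?_ hlt
          (Finset.sum_le_sum fun b _ => hterm b (Finset.mem_univ b))
        exact ENNReal.sum_ne_top.mpr fun b _ =>
          ne_top_of_le_ne_top (hfin b) (hterm b (Finset.mem_univ b))
      rw [h₁, h₂] at this
      exact lt_irrefl _ this
    have hm0 : ENNReal.ofReal (m a) ≠ 0 := left_ne_zero_of_mul ha
    have he0 := right_ne_zero_of_mul ha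
    have heq' := (ENNReal.mul_right_inj hm0 ENNReal.ofReal_ne_top).mp heq
    have het : expQ (qOf α) ((v a - l₂) / κ) ≠ ∞ := by
      intro hcon
      apply hfin a
      rw [← heq', hcon, ENNReal.mul_top hm0]
    have := expQ_inj heq' he0 het
    rw [div_left_inj' hκ.ne'] at this
    linarith
  obtain ⟨l, hl⟩ := hex
  refine ⟨l, hl, fun l' hl' => ?_⟩
  rcases le_total l l' with h | h
  · exact (key l l' hl hl' h).symm
  · exact key l' l hl' hl h

theorem normSum_lamBar (α : ℝ) {κ : ℝ} (hκ : 0 < κ) (v : A → ℝ) {m : A → ℝ}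
    (hm : m ∈ stdSimplex ℝ A) : normSum α κ v m (lamBar α κ v m) = 1 :=
  Classical.epsilon_spec (existsUnique_normSum_eq_one α hκ v hm).exists

end Divergence

section Problem

variable {Θ A : Type*} [Fintype Θ]

/-- The `α`-mean `M_α[x] = h_α⁻¹ (∑ θ, π θ * h_α[x θ])`. -/
def alphaMean (α : ℝ) (π : Θ → ℝ) (x : Θ → ℝ≥0∞) : ℝ≥0∞ :=
  hInv α (∑ θ, (π θ : EReal) * h α (x θ))

/-- `U(P)`: the union of the supports of the `P θ`. -/
def unionSupp (P : Θ → A → ℝ) : Set A := ⋃ θ, Function.support (P θ)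

/-- `C(P)`: the intersection of the supports of the `P θ`. -/
def commonSupp (P : Θ → A → ℝ) : Set A := ⋂ θ, Function.support (P θ)

open Classical in
/-- The set on which the `α`-integration is carried: `U(P)` if `α < 1`, `C(P)` if `α ≥ 1`. -/
def carrier (α : ℝ) (P : Θ → A → ℝ) : Set A := if α < 1 then unionSupp P else commonSupp P

/-- `M_α[P(a)]` for the vector `P(a) = (P_θ(a))_θ`. -/
def meanAt (α : ℝ) (π : Θ → ℝ) (P : Θ → A → ℝ) (a : A) : ℝ :=
  (alphaMean α π fun θ => ENNReal.ofReal (P θ a)).toReal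

variable [Fintype A]

open Classical in
/-- The normalizer `Z_α(P)`. -/
def alphaZ (α : ℝ) (π : Θ → ℝ) (P : Θ → A → ℝ) : ℝ :=
  ∑ a, if a ∈ carrier α P then meanAt α π P a else 0

open Classical in
/-- The `α`-integration `m_α^P` of `P`. -/
def alphaIntegration (α : ℝ) (π : Θ → ℝ) (P : Θ → A → ℝ) (a : A) : ℝ :=
  if a ∈ carrier α P then meanAt α π P a / alphaZ α π P else 0

/-- The condition under which the `α`-integration is defined. -/
def HasAlphaIntegration (α : ℝ) (P : Θ → A → ℝ) : Prop :=
  α < 1 ∨ (1 ≤ α ∧ (commonSupp P).Nonempty)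

/-- The `α`-information `I_α(P) = min_{m ∈ Δ(A)} ∑ θ, π θ * D_α[P θ : m]`, possibly `+∞`. -/
def alphaInformation (α : ℝ) (π : Θ → ℝ) (P : Θ → A → ℝ) : EReal :=
  ⨅ m ∈ stdSimplex ℝ A, ∑ θ, (π θ : EReal) * alphaDiv α (P θ) m

/-- Stochastic choice rules: each `P θ` is a probability vector on the actions. -/
def IsChoiceRule (P : Θ → A → ℝ) : Prop := ∀ θ, P θ ∈ stdSimplex ℝ A

/-- Objective of the information acquisition problem. -/
def objective (α κ : ℝ) (π : Θ → ℝ) (u : A → Θ → ℝ) (P : Θ → A → ℝ) : EReal :=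
  ((∑ θ, π θ * ∑ a, P θ a * u a θ : ℝ) : EReal) - (κ : EReal) * alphaInformation α π P

/-- `P` solves the information acquisition problem. -/
def IsOptimal (α κ : ℝ) (π : Θ → ℝ) (u : A → Θ → ℝ) (P : Θ → A → ℝ) : Prop :=
  IsChoiceRule P ∧ ∀ Q, IsChoiceRule Q → objective α κ π u Q ≤ objective α κ π u P

/-- `∑ θ, π θ * h_α[exp_{q_α} ((u(a, θ) - λ_θ) / κ)]`, possibly `+∞`. -/
def actionValue (α κ : ℝ) (π : Θ → ℝ) (u : A → Θ → ℝ) (lam : Θ → ℝ) (a : A) : EReal :=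
  ∑ θ, (π θ : EReal) * h α (expQ (qOf α) ((u a θ - lam θ) / κ))

end Problem

end AlphaInfo

end

noncomputable section

namespace AlphaInfo

open scoped ENNReal Topology
open Filter

/-! Put `s = (1 - α) / 2`. Between probability vectors the `α`-divergence is a sum of perspectives
`q * f (p / q)` of one convex generator `f`. Its derivative inverts the `q`-exponential with `q_α =
2 - s`, and its conjugate `f*` satisfies `h_α ∘ exp_q = 1 + s * f*` (just `f*` when `s = 0`). So
condition 2 says that the averaged conjugate `∑ θ, π θ * f*((u a θ - λ θ) / κ)` is largest on the
support of `m`; the sign of `s` decides whether this reads as a maximum or as a minimum of action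
values.

The average divergence from `P` to `n` equals a nonnegative multiple of the divergence from `m_α^P`
to `n`, plus terms constant on the simplex (`exists_pythagoras`). Hence `m_α^P` attains the minimum
in `I_α`, and optimality becomes joint maximality of the net payoff in a rule `Q` and a reference
`n` (`isOptimal_iff_jointPayoff`).

Fenchel's inequality `p * y ≤ q * f (p / q) + q * f*(y)` then does the work. At one state it bounds
the net payoff by a dual value; the constant `λ_θ` makes the dual point feasible, and equality term
by term characterizes the solutions (`isStateSolution_iff`). Averaged over states, the bound is
linear in `n`, with the averaged conjugates as coefficients. Condition 2 bounds it by its value at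
`m`, which proves sufficiency (`jointPayoff_le_of_dualCondition`).

For necessity, `P` must solve each state problem with `m` fixed. Then an infinitesimal mass `ε` of
`m` and `ε * τ θ` of each `P θ` is moved to an action `b` (`first_order_condition`). Taking the
supremum over the likelihood ratios `τ θ > 0` turns `τ * y - f τ` into `f*(y)`, and condition 2
results. -/

/-! ### The generator, its conjugate and Fenchel's inequality. -/

/-- The perspective `q * f (p / q)` of the normalized generator `f` of the divergence of
index `s = (1 - α) / 2`, as a real number (meaningful under `LocFin`). -/
def locDiv (s p q : ℝ) : ℝ :=
  if s = 1 then p * Real.log (p / q) - p + q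
  else if s = 0 then q * Real.log (q / p) - q + p
  else (s * p + (1 - s) * q - p ^ s * q ^ (1 - s)) / (s * (1 - s))

/-- The local divergence at `(p, q)` is finite. -/
def LocFin (s p q : ℝ) : Prop := (1 ≤ s → q = 0 → p = 0) ∧ (s ≤ 0 → p = 0 → q = 0)

/-- The value of the `q`-exponential, as a real number. -/
def expR (s y : ℝ) : ℝ := (expQ (2 - s) y).toReal

/-- The convex conjugate of the generator. -/
def genConj (s y : ℝ) : ℝ :=
  if s = 0 then Real.log (expR s y) else (expR s y ^ s - 1) / s

/-- The derivative of the generator, inverse to `expR`. -/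
def genDeriv (s t : ℝ) : ℝ :=
  if s = 1 then Real.log t else (t ^ (s - 1) - 1) / (s - 1)

/-- Bernoulli's inequality for `x⁻¹` with exponent `1 - s > 1`, multiplied by `x`. -/
theorem rpow_neg_gt {s x : ℝ} (hs : s < 0) (hx : 0 < x) (hx1 : x ≠ 1) :
    1 + s * (x - 1) < x ^ s := by
  have hw : 0 < x⁻¹ := inv_pos.mpr hx
  have h := one_add_mul_self_lt_rpow_one_add (s := x⁻¹ - 1) (by linarith)
    (by intro h; apply hx1; rw [← inv_inv x, sub_eq_zero.mp h, inv_one]) (p := 1 - s) (by linarith)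
  rw [show 1 + (x⁻¹ - 1) = x⁻¹ by ring, Real.inv_rpow hx.le, Real.rpow_sub hx, Real.rpow_one] at h
  have h2 : (x / x ^ s)⁻¹ * x = x ^ s := by
    have := (Real.rpow_pos_of_pos hx s).ne'
    field_simp
  calc 1 + s * (x - 1) = (1 + (1 - s) * (x⁻¹ - 1)) * x := by field_simp; ring
    _ < (x / x ^ s)⁻¹ * x := mul_lt_mul_of_pos_right h hx
    _ = x ^ s := h2

/-- The generator is strictly convex with minimum `0` at `1`. In each range of `s` this is a form of
Bernoulli's inequality, or `log x < x - 1` in the two limiting cases. -/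
theorem locDiv_one_pos {s x : ℝ} (hx : 0 ≤ x) (hf : LocFin s x 1) (hx1 : x ≠ 1) :
    0 < locDiv s x 1 := by
  unfold locDiv
  split_ifs with h1 h0
  · rcases hx.eq_or_lt with rfl | hx
    · simp
    · have := Real.log_lt_sub_one_of_pos (inv_pos.mpr hx) (by simpa using hx1)
      rw [Real.log_inv] at this
      have h3 : x * (-Real.log x) < x * (x⁻¹ - 1) := mul_lt_mul_of_pos_left this hx
      rw [mul_sub, mul_inv_cancel₀ hx.ne'] at h3
      rw [div_one]; linarith
  · have hx : 0 < x := lt_of_le_of_ne hx fun h => by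
      have := hf.2 h0.le h.symm
      norm_num at this
    have := Real.log_lt_sub_one_of_pos hx hx1
    rw [one_div, Real.log_inv]; linarith
  · rw [Real.one_rpow]
    rcases lt_trichotomy s 0 with hs | hs | hs
    · have hx : 0 < x := lt_of_le_of_ne hx fun h => by
        have := hf.2 hs.le h.symm
        norm_num at this
      have := rpow_neg_gt hs hx hx1
      exact div_pos_of_neg_of_neg (by linarith) (mul_neg_of_neg_of_pos hs (by linarith))
    · exact absurd hs h0
    · rcases lt_or_gt_of_ne h1 with h | h
      · have := rpow_one_add_lt_one_add_mul_self (s := x - 1) (by linarith) (sub_ne_zero.mpr hx1)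
          hs h
        rw [add_sub_cancel] at this
        exact div_pos (by linarith) (mul_pos hs (by linarith))
      · have := one_add_mul_self_lt_rpow_one_add (s := x - 1) (by linarith) (sub_ne_zero.mpr hx1) h
        rw [add_sub_cancel] at this
        exact div_pos_of_neg_of_neg (by linarith) (mul_neg_of_pos_of_neg hs (by linarith))

theorem locDiv_self (s x : ℝ) (hx : 0 ≤ x) : locDiv s x x = 0 := by
  rcases hx.eq_or_lt with rfl | hx
  · unfold locDiv
    split_ifs with h1 h0
    · simp
    · simp
    · rw [Real.zero_rpow h0]; simp
  · unfold locDiv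
    split_ifs
    · simp [hx.ne']
    · simp [hx.ne']
    · rw [← Real.rpow_add hx, add_sub_cancel, Real.rpow_one]; ring

theorem locDiv_one_nonneg {s x : ℝ} (hx : 0 ≤ x) (hf : LocFin s x 1) : 0 ≤ locDiv s x 1 := by
  by_cases h : x = 1
  · rw [h, locDiv_self _ _ zero_le_one]
  · exact (locDiv_one_pos hx hf h).le

theorem expQ_slope {s t : ℝ} (ht : 0 < t) : expQ (2 - s) (genDeriv s t) = ENNReal.ofReal t := by
  unfold expQ genDeriv
  by_cases h1 : s = 1
  · subst h1; norm_num [Real.exp_log ht]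
  · have h2 : s - 1 ≠ 0 := sub_ne_zero.mpr h1
    rw [if_neg (by intro h; apply h1; linarith), if_neg h1]
    rw [show 1 - (2 - s) = s - 1 by ring, mul_div_cancel₀ _ h2, add_sub_cancel,
      ENNReal.ofReal_rpow_of_pos (Real.rpow_pos_of_pos ht _), ← Real.rpow_mul ht.le,
      mul_one_div_cancel h2, Real.rpow_one]

theorem expR_slope {s t : ℝ} (ht : 0 < t) : expR s (genDeriv s t) = t := by
  rw [expR, expQ_slope ht, ENNReal.toReal_ofReal ht.le]

theorem slope_expR {s y : ℝ} (h0 : expQ (2 - s) y ≠ 0) (ht : expQ (2 - s) y ≠ ∞) :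
    genDeriv s (expR s y) = y := by
  refine (expQ_inj ?_ h0 ht).symm
  rw [expQ_slope (by exact ENNReal.toReal_pos h0 ht), expR, ENNReal.ofReal_toReal ht]

theorem expQ_eq_zero {s y : ℝ} (h : expQ (2 - s) y = 0) : 1 < s ∧ 1 + (s - 1) * y ≤ 0 := by
  unfold expQ at h
  split_ifs at h with h1
  · exact absurd (ENNReal.ofReal_eq_zero.mp h) (not_le.mpr (Real.exp_pos y))
  · rw [show 1 - (2 - s) = s - 1 by ring, ENNReal.rpow_eq_zero_iff] at h
    rcases h with h | h
    · exact ⟨by have := one_div_pos.mp h.2; linarith, ENNReal.ofReal_eq_zero.mp h.1⟩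
    · exact absurd h.1 ENNReal.ofReal_ne_top

theorem expQ_eq_top {s y : ℝ} : expQ (2 - s) y = ∞ ↔ s < 1 ∧ 1 + (s - 1) * y ≤ 0 := by
  unfold expQ
  split_ifs with h1
  · simp only [ENNReal.ofReal_ne_top, false_iff, not_and]
    intro h; linarith
  · rw [show 1 - (2 - s) = s - 1 by ring, ENNReal.rpow_eq_top_iff]
    simp only [ENNReal.ofReal_eq_zero, ENNReal.ofReal_ne_top, false_and, or_false, one_div,
      inv_lt_zero, sub_neg]
    exact and_comm

/-- The gap in Fenchel's inequality is again a local divergence. -/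
theorem fenchel_gap {s p q t : ℝ} (hp : 0 ≤ p) (hq : 0 < q) (ht : 0 < t) (hf : LocFin s p q) :
    locDiv s p q + q * genConj s (genDeriv s t) - p * genDeriv s t =
      q * t ^ s * locDiv s (p / (q * t)) 1 := by
  have hqt : 0 < q * t := mul_pos hq ht
  unfold locDiv genConj
  rw [expR_slope ht]
  unfold genDeriv
  by_cases h1 : s = 1
  · subst h1
    simp only [if_true, one_ne_zero, if_false, Real.rpow_one, div_one]
    rcases hp.eq_or_lt with rfl | hp
    · simp; ring
    · rw [Real.log_div hp.ne' hqt.ne', Real.log_div hp.ne' hq.ne', Real.log_mul hq.ne' ht.ne']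
      field_simp
      ring
  · by_cases h0 : s = 0
    · subst h0
      have hp : 0 < p := lt_of_le_of_ne hp fun h => hq.ne' (hf.2 le_rfl h.symm)
      simp only [if_true, zero_ne_one, if_false, Real.rpow_zero, one_div]
      rw [Real.log_inv, Real.log_div hq.ne' hp.ne', Real.log_div hp.ne' hqt.ne',
        Real.log_mul hq.ne' ht.ne', zero_sub, Real.rpow_neg_one]
      field_simp
      ring
    · simp only [h1, h0, if_false, Real.one_rpow, mul_one]
      have h2 : s - 1 ≠ 0 := sub_ne_zero.mpr h1
      have h3 : 1 - s ≠ 0 := sub_ne_zero.mpr (Ne.symm h1)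
      rw [Real.div_rpow hp hqt.le, Real.mul_rpow hq.le ht.le, Real.rpow_sub hq, Real.rpow_one,
        Real.rpow_sub ht, Real.rpow_one]
      have := (Real.rpow_pos_of_pos hq s).ne'
      have := (Real.rpow_pos_of_pos ht s).ne'
      field_simp
      ring

theorem LocFin.div {s p q c : ℝ} (hq : 0 < q) (hc : 0 < c) (hf : LocFin s p q) :
    LocFin s (p / c) 1 := by
  refine ⟨fun _ h => absurd h one_ne_zero, fun h h' => ?_⟩
  rcases div_eq_zero_iff.mp h' with h' | h'
  · exact absurd (hf.2 h h') hq.ne'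
  · exact absurd h' hc.ne'

/-- The perspective at `q = 0` is the recession function of the generator, of slope `1 / (1 - s)`
when `s < 1`. This slope is the source of the term `2 * κ / (1 + α)` in `lamZero`. -/
theorem locDiv_zero_right {s p : ℝ} (hf : LocFin s p 0) :
    (s < 1 ∧ locDiv s p 0 = p / (1 - s)) ∨ (p = 0 ∧ locDiv s p 0 = 0) := by
  rcases lt_or_ge s 1 with h | h
  · left
    refine ⟨h, ?_⟩
    unfold locDiv
    have h3 : 1 - s ≠ 0 := by linarith
    rw [if_neg h.ne]
    split_ifs with h0
    · simp [h0]
    · rw [Real.zero_rpow h3]; field_simp; ring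
  · right
    have := hf.1 h rfl
    subst this
    exact ⟨rfl, locDiv_self s 0 le_rfl⟩

/-- Fenchel's inequality. -/
theorem fenchel {s p q y : ℝ} (hp : 0 ≤ p) (hq : 0 ≤ q) (hf : LocFin s p q)
    (hd : s < 1 → 0 ≤ 1 + (s - 1) * y) (hy : q = 0 ∨ expQ (2 - s) y ≠ ∞ ∨ s < 0) :
    p * y ≤ locDiv s p q + q * genConj s y := by
  rcases hq.eq_or_lt with rfl | hq
  · rcases locDiv_zero_right hf with ⟨h, h'⟩ | ⟨h, h'⟩
    · have := hd h
      rw [h', zero_mul, add_zero, le_div_iff₀ (by linarith)]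
      nlinarith
    · rw [h', h]; simp
  · by_cases ht : expQ (2 - s) y = ∞
    · have hs : s < 0 := by
        rcases hy with h | h | h
        · exact absurd h hq.ne'
        · exact absurd ht h
        · exact h
      have h2 := (expQ_eq_top.mp ht).2
      have h3 := hd (by linarith)
      -- `expR` reads `∞` as `0`, and the real power `0 ^ s` is `0` for `s ≠ 0`. As `∞ ^ s = 0` for
      -- `s < 0`, the formula still gives the true conjugate.
      have hc : genConj s y = -1 / s := by
        simp [genConj, hs.ne, expR, ht, Real.zero_rpow]
      -- The bracket is both `≤ 0` and `≥ 0`, so `y` is exactly the recession slope.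
      have hy' : y = 1 / (1 - s) := by
        rw [eq_div_iff (by linarith)]; linarith
      rw [hc, hy', locDiv, if_neg (by linarith), if_neg hs.ne]
      have h5 : 0 ≤ (p ^ s * q ^ (1 - s)) / (-s * (1 - s)) := by
        apply div_nonneg (by positivity)
        nlinarith
      have h3 : 1 - s ≠ 0 := by linarith
      have h4 := hs.ne
      have : (s * p + (1 - s) * q - p ^ s * q ^ (1 - s)) / (s * (1 - s)) + q * (-1 / s)
        = p * (1 / (1 - s)) + (p ^ s * q ^ (1 - s)) / (-s * (1 - s)) := by
        field_simp; ring
      linarith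
    · by_cases h0 : expQ (2 - s) y = 0
      · obtain ⟨h1, h2⟩ := expQ_eq_zero h0
        have h4 : s ≠ 0 := by linarith
        have h3 : 1 - s ≠ 0 := by linarith
        have hc : genConj s y = -1 / s := by
          simp [genConj, h4, expR, h0, Real.zero_rpow]
        rw [hc, locDiv, if_neg (by linarith), if_neg h4]
        have h5 : 0 ≤ (p ^ s * q ^ (1 - s)) / (s * (s - 1)) := by
          apply div_nonneg (by positivity)
          nlinarith
        have h6 : p * y ≤ - (p / (s - 1)) := by
          rw [← neg_div, le_div_iff₀ (by linarith)]
          nlinarith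
        have h7 : s - 1 ≠ 0 := by linarith
        have : (s * p + (1 - s) * q - p ^ s * q ^ (1 - s)) / (s * (1 - s)) + q * (-1 / s)
          = - (p / (s - 1)) + (p ^ s * q ^ (1 - s)) / (s * (s - 1)) := by
          rw [show 1 - s = -(s - 1) by ring]
          field_simp; ring
        linarith
      · have hE := ENNReal.toReal_pos h0 ht
        have hg := fenchel_gap hp hq hE hf
        have hs : genDeriv s (expQ (2 - s) y).toReal = y := slope_expR h0 ht
        rw [hs] at hg
        have := locDiv_one_nonneg (div_nonneg hp (mul_pos hq hE).le) (hf.div hq (mul_pos hq hE))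
        have h8 : 0 ≤ q * (expQ (2 - s) y).toReal ^ s := by positivity
        nlinarith [mul_nonneg h8 this]

/-- The gap in Fenchel's inequality is a positive multiple of a local divergence, which vanishes
only at ratio `1`. When the exponential is `0`, the gap contains the term `p ^ s * q ^ (1 - s) / (s
* (s - 1))`, positive unless `p = 0`. -/
theorem eq_of_fenchel_eq {s p q y : ℝ} (hp : 0 ≤ p) (hq : 0 < q) (hf : LocFin s p q)
    (ht : expQ (2 - s) y ≠ ∞) (he : p * y = locDiv s p q + q * genConj s y) :
    p = q * expR s y := by
  by_cases h0 : expQ (2 - s) y = 0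
  · obtain ⟨h1, h2⟩ := expQ_eq_zero h0
    have h4 : s ≠ 0 := by linarith
    have h3 : 1 - s ≠ 0 := by linarith
    have h7 : s - 1 ≠ 0 := by linarith
    have hc : genConj s y = -1 / s := by
      simp [genConj, h4, expR, h0, Real.zero_rpow]
    rw [hc, locDiv, if_neg (by linarith), if_neg h4] at he
    have h6 : p * y ≤ - (p / (s - 1)) := by
      rw [← neg_div, le_div_iff₀ (by linarith)]
      nlinarith
    have : (s * p + (1 - s) * q - p ^ s * q ^ (1 - s)) / (s * (1 - s)) + q * (-1 / s)
      = - (p / (s - 1)) + (p ^ s * q ^ (1 - s)) / (s * (s - 1)) := by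
      rw [show 1 - s = -(s - 1) by ring]
      field_simp; ring
    rw [expR, h0, ENNReal.toReal_zero, mul_zero]
    by_contra hp0
    have : 0 < (p ^ s * q ^ (1 - s)) / (s * (s - 1)) := by
      have hp := lt_of_le_of_ne hp (Ne.symm hp0)
      have : 0 < s * (s - 1) := by nlinarith
      positivity
    linarith
  · have hE : 0 < expR s y := ENNReal.toReal_pos h0 ht
    have hg := fenchel_gap hp hq hE hf
    rw [slope_expR h0 ht, ← he, sub_self, eq_comm] at hg
    have h8 : 0 < q * expR s y ^ s := by positivity
    have hz := (mul_eq_zero.mp hg).resolve_left h8.ne'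
    by_contra hne
    refine (locDiv_one_pos (div_nonneg hp (mul_pos hq hE).le) (hf.div hq (mul_pos hq hE)) ?_).ne' hz
    rwa [Ne, div_eq_one_iff_eq (mul_pos hq hE).ne']

theorem locFin_mul_expR {s q y : ℝ} (hq : 0 < q) (ht : expQ (2 - s) y ≠ ∞) :
    LocFin s (q * expR s y) q := by
  refine ⟨fun _ h => absurd h hq.ne', fun hs h => ?_⟩
  rcases mul_eq_zero.mp h with h | h
  · exact h
  · rcases (ENNReal.toReal_eq_zero_iff _).mp h with h | h
    · have := (expQ_eq_zero h).1; linarith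
    · exact absurd h ht

theorem fenchel_eq {s q y : ℝ} (hq : 0 < q) (ht : expQ (2 - s) y ≠ ∞) :
    q * expR s y * y = locDiv s (q * expR s y) q + q * genConj s y := by
  by_cases h0 : expQ (2 - s) y = 0
  · obtain ⟨h1, h2⟩ := expQ_eq_zero h0
    have h4 : s ≠ 0 := by linarith
    have h3 : 1 - s ≠ 0 := by linarith
    have hc : genConj s y = -1 / s := by
      simp [genConj, h4, expR, h0, Real.zero_rpow]
    rw [hc, locDiv, if_neg (by linarith), if_neg h4, expR, h0, ENNReal.toReal_zero, mul_zero,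
      Real.zero_rpow h4]
    field_simp; ring
  · have hE : 0 < expR s y := ENNReal.toReal_pos h0 ht
    have hg := fenchel_gap (mul_nonneg hq.le hE.le) hq hE (locFin_mul_expR hq ht)
    rw [slope_expR h0 ht, div_self (mul_pos hq hE).ne', locDiv_self s 1 zero_le_one] at hg
    linarith

/-- Subadditivity of the perspective: take the slope `y` at the pooled ratio, where Fenchel's
inequality is an equality for the sum, and apply the inequality to each summand. -/
theorem locDiv_add_le {s p q p' q' : ℝ} (hp : 0 ≤ p) (hq : 0 ≤ q) (hf : LocFin s p q)
    (hp' : 0 < p') (hq' : 0 < q') :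
    LocFin s (p + p') (q + q') ∧ locDiv s (p + p') (q + q') ≤ locDiv s p q + locDiv s p' q' := by
  have hP : 0 < p + p' := by linarith
  have hQ : 0 < q + q' := by linarith
  have hF : LocFin s (p + p') (q + q') := ⟨fun _ h => absurd h hQ.ne', fun _ h => absurd h hP.ne'⟩
  refine ⟨hF, ?_⟩
  have ht : 0 < (p + p') / (q + q') := div_pos hP hQ
  set y := genDeriv s ((p + p') / (q + q')) with hy
  have hE : expQ (2 - s) y ≠ ∞ := by rw [hy, expQ_slope ht]; exact ENNReal.ofReal_ne_top
  have hd : s < 1 → 0 ≤ 1 + (s - 1) * y := fun hs => by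
    by_contra hcon
    exact hE (expQ_eq_top.mpr ⟨hs, (not_le.mp hcon).le⟩)
  have h1 := fenchel hp hq hf hd (Or.inr (Or.inl hE))
  have h2 := fenchel hp'.le hq'.le (s := s)
    ⟨fun _ h => absurd h hq'.ne', fun _ h => absurd h hp'.ne'⟩ hd (Or.inr (Or.inl hE))
  have h3 := fenchel_eq hQ hE
  rw [hy, expR_slope ht, mul_div_cancel₀ _ hQ.ne', ← hy] at h3
  linarith

theorem locDiv_mul {s p q c : ℝ} (hp : 0 ≤ p) (hq : 0 ≤ q) (hc : 0 < c) :
    locDiv s (c * p) (c * q) = c * locDiv s p q := by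
  unfold locDiv
  split_ifs
  · rw [mul_div_mul_left _ _ hc.ne']; ring
  · rw [mul_div_mul_left _ _ hc.ne']; ring
  · rw [Real.mul_rpow hc.le hp, Real.mul_rpow hc.le hq]
    have : c ^ s * c ^ (1 - s) = c := by rw [← Real.rpow_add hc]; simp
    linear_combination (-(p ^ s * q ^ (1 - s)) / (s * (1 - s))) * this

/-- The conjugate is a supremum over positive likelihood ratios. -/
theorem exists_lt_linear_sub_locDiv {s y c : ℝ}
    (h : (0 ≤ s ∧ expQ (2 - s) y = ∞) ∨ c < genConj s y) :
    ∃ τ : ℝ, 0 < τ ∧ c < τ * y - locDiv s τ 1 := by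
  by_cases ht : expQ (2 - s) y = ∞
  · obtain ⟨hs, hy⟩ := expQ_eq_top.mp ht
    have h3 : 1 - s ≠ 0 := by linarith
    have hy' : 1 / (1 - s) ≤ y := by rw [div_le_iff₀ (by linarith)]; linarith
    by_cases h0 : s = 0
    · subst h0
      -- Here `f τ = τ - 1 - log τ` and `y ≥ 1`, so the value at `τ` is at least `log τ + 1`, which
      -- is `c + 1`.
      refine ⟨Real.exp c, Real.exp_pos c, ?_⟩
      rw [locDiv, if_neg zero_ne_one, if_pos rfl, one_div, Real.log_inv, Real.log_exp]
      have : Real.exp c * 1 ≤ Real.exp c * y :=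
        mul_le_mul_of_nonneg_left (by simpa using hy') (Real.exp_pos c).le
      linarith
    -- Replacing `y` by the recession slope cancels the linear part. As `τ → ∞` the remaining bound
    -- tends to `-1 / s` if `s < 0` and to `∞` if `s > 0`.
    · have key : ∀ τ : ℝ, 0 < τ →
          -1 / s + τ ^ s / (s * (1 - s)) ≤ τ * y - locDiv s τ 1 := by
        intro τ hτ
        rw [locDiv, if_neg hs.ne, if_neg h0, Real.one_rpow]
        have := mul_le_mul_of_nonneg_left hy' hτ.le
        have h5 : τ * (1 / (1 - s)) - (s * τ + (1 - s) * 1 - τ ^ s * 1) / (s * (1 - s)) =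
          -1 / s + τ ^ s / (s * (1 - s)) := by field_simp; ring
        linarith
      rcases lt_or_gt_of_ne h0 with h1 | h1
      · have hc : c < -1 / s := by
          rcases h with h | h
          · linarith [h.1]
          · simpa [genConj, h0, expR, ht, Real.zero_rpow h0] using h
        have hl : Tendsto (fun τ : ℝ => -1 / s + τ ^ s / (s * (1 - s))) atTop (𝓝 (-1 / s)) := by
          have := tendsto_rpow_neg_atTop (y := -s) (by linarith)
          rw [neg_neg] at this
          simpa using (this.div_const (s * (1 - s))).const_add (-1 / s)
        obtain ⟨τ, hτ1, hτ2⟩ := ((hl.eventually (lt_mem_nhds hc)).and (eventually_gt_atTop 0)).exists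
        exact ⟨τ, hτ2, hτ1.trans_le (key τ hτ2)⟩
      · have hl : Tendsto (fun τ : ℝ => -1 / s + τ ^ s / (s * (1 - s))) atTop atTop :=
          tendsto_atTop_add_const_left _ _
            ((tendsto_rpow_atTop h1).atTop_div_const (mul_pos h1 (by linarith)))
        obtain ⟨τ, hτ1, hτ2⟩ := ((hl.eventually_gt_atTop c).and (eventually_gt_atTop 0)).exists
        exact ⟨τ, hτ2, hτ1.trans_le (key τ hτ2)⟩
  · have hc : c < genConj s y := by
      rcases h with h | h
      · exact absurd h.2 ht
      · exact h
    by_cases h0 : expQ (2 - s) y = 0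
    · obtain ⟨h1, h2⟩ := expQ_eq_zero h0
      have h4 : s ≠ 0 := by linarith
      have h3 : 1 - s ≠ 0 := by linarith
      have hc' : genConj s y = -1 / s := by
        simp [genConj, h4, expR, h0, Real.zero_rpow]
      -- The supremum is attained at `τ = 0`, which is not admissible; it is approached from the
      -- right.
      have hcont : ContinuousAt (fun τ : ℝ => τ * y - locDiv s τ 1) 0 := by
        have : ContinuousAt (fun τ : ℝ => τ ^ s) 0 :=
          Real.continuousAt_rpow_const 0 s (Or.inr (by linarith))
        simp only [locDiv, if_neg h1.ne', if_neg h4, Real.one_rpow]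
        fun_prop
      have hv : 0 * y - locDiv s 0 1 = -1 / s := by
        simp only [locDiv, if_neg h1.ne', if_neg h4, Real.one_rpow, Real.zero_rpow h4]
        field_simp
        ring
      have hl := hcont.tendsto.mono_left (nhdsWithin_le_nhds (s := Set.Ioi 0))
      rw [hv, ← hc'] at hl
      obtain ⟨τ, hτ1, hτ2⟩ := ((hl.eventually (lt_mem_nhds hc)).and self_mem_nhdsWithin).exists
      exact ⟨τ, hτ2, hτ1⟩
    -- The maximizer is the point where the generator has slope `y`.
    · refine ⟨expR s y, ENNReal.toReal_pos h0 ht, ?_⟩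
      have := fenchel_eq zero_lt_one ht
      rw [one_mul, one_mul] at this
      linarith

/-- The partial derivatives are `y` in `p` and `-f*(y)` in `q`; the Fenchel equality then eliminates
`p * y`. Rescaling `p` and `q` keeps zeros in place, so the derivative exists even at the boundary.
-/
theorem hasDerivAt_locDiv {s p q y : ℝ} (τ : ℝ) (hq : 0 ≤ q) (hf : LocFin s p q)
    (h : 0 < q → expQ (2 - s) y ≠ ∞ ∧ p = q * expR s y) :
    HasDerivAt (fun ε : ℝ => locDiv s ((1 - ε * τ) * p) ((1 - ε) * q))
      ((1 - τ) * (q * genConj s y) - τ * locDiv s p q) 0 := by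
  have hA : HasDerivAt (fun ε : ℝ => (1 - ε * τ) * p) (-τ * p) 0 := by
    simpa using (((hasDerivAt_id (0 : ℝ)).mul_const τ).const_sub 1).mul_const p
  have hB : HasDerivAt (fun ε : ℝ => (1 - ε) * q) (-q) 0 := by
    simpa using ((hasDerivAt_id (0 : ℝ)).const_sub 1).mul_const q
  rcases hq.eq_or_lt with rfl | hq
  -- With `q = 0` only the recession function is left, and it is linear in `p`.
  · have hlin : ∀ c : ℝ, locDiv s (c * p) 0 = c * locDiv s p 0 := by
      intro c
      rcases locDiv_zero_right hf with ⟨h, h'⟩ | ⟨h, h'⟩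
      · have hf' : LocFin s (c * p) 0 := ⟨fun h2 => absurd h h2.not_gt, fun _ _ => rfl⟩
        rcases locDiv_zero_right hf' with ⟨_, h2⟩ | ⟨h1, h2⟩
        · rw [h2, h']; ring
        · rw [h2, h', ← mul_div_assoc, h1, zero_div]
      · subst h; simp [h']
    simp only [mul_zero, hlin, zero_mul, zero_sub]
    simpa using (((hasDerivAt_id (0 : ℝ)).mul_const τ).const_sub 1).mul_const (locDiv s p 0)
  · obtain ⟨ht, hp⟩ := h hq
    have hE0 : 0 ≤ expR s y := ENNReal.toReal_nonneg
    by_cases h1 : s = 1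
    · have hE : 0 < expR s y := by
        refine ENNReal.toReal_pos (fun h0 => ?_) ht
        have := (expQ_eq_zero h0).1; linarith
      have hp0 : 0 < p := hp ▸ mul_pos hq hE
      have hd : HasDerivAt (fun ε : ℝ => (1 - ε * τ) * p *
          (Real.log ((1 - ε * τ) * p) - Real.log ((1 - ε) * q)) - (1 - ε * τ) * p + (1 - ε) * q)
          (-τ * p * (Real.log p - Real.log q) + p * (-τ * p / p - -q / q) - -τ * p + -q) 0 := by
        have := ((hA.mul ((hA.log (by simpa using hp0.ne')).sub
          (hB.log (by simpa using hq.ne')))).sub hA).add hB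
        refine this.congr_deriv ?_
        simp
      have hev : (fun ε : ℝ => locDiv s ((1 - ε * τ) * p) ((1 - ε) * q)) =ᶠ[𝓝 0]
          (fun ε : ℝ => (1 - ε * τ) * p *
          (Real.log ((1 - ε * τ) * p) - Real.log ((1 - ε) * q)) - (1 - ε * τ) * p +
            (1 - ε) * q) := by
        filter_upwards [hA.continuousAt.eventually_ne (y := 0) (by simpa using hp0.ne'),
          hB.continuousAt.eventually_ne (y := 0) (by simpa using hq.ne')] with ε e1 e2
        rw [locDiv, if_pos h1, Real.log_div e1 e2]
      refine (hd.congr_of_eventuallyEq hev).congr_deriv ?_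
      rw [locDiv, if_pos h1, genConj, if_neg (by linarith), Real.log_div hp0.ne' hq.ne', h1,
        Real.rpow_one, div_one]
      rw [h1] at hp
      have : q * (expR 1 y - 1) = p - q := by rw [hp]; ring
      rw [this]
      field_simp
      ring
    · by_cases h0 : s = 0
      · have hp0 : 0 < p := by
          rw [hp]
          refine mul_pos hq (ENNReal.toReal_pos (fun h0 => ?_) ht)
          have := (expQ_eq_zero h0).1; linarith
        have hE : 0 < expR s y := by
          rw [hp] at hp0; exact pos_of_mul_pos_right hp0 hq.le
        have hd : HasDerivAt (fun ε : ℝ => (1 - ε) * q *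
            (Real.log ((1 - ε) * q) - Real.log ((1 - ε * τ) * p)) - (1 - ε) * q + (1 - ε * τ) * p)
            (-q * (Real.log q - Real.log p) + q * (-q / q - -τ * p / p) - -q + -τ * p) 0 := by
          have := ((hB.mul ((hB.log (by simpa using hq.ne')).sub
            (hA.log (by simpa using hp0.ne')))).sub hB).add hA
          refine this.congr_deriv ?_
          simp
        have hev : (fun ε : ℝ => locDiv s ((1 - ε * τ) * p) ((1 - ε) * q)) =ᶠ[𝓝 0]
            (fun ε : ℝ => (1 - ε) * q *
            (Real.log ((1 - ε) * q) - Real.log ((1 - ε * τ) * p)) - (1 - ε) * q +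
              (1 - ε * τ) * p) := by
          filter_upwards [hA.continuousAt.eventually_ne (y := 0) (by simpa using hp0.ne'),
            hB.continuousAt.eventually_ne (y := 0) (by simpa using hq.ne')] with ε e1 e2
          rw [locDiv, if_neg h1, if_pos h0, Real.log_div e2 e1]
        refine (hd.congr_of_eventuallyEq hev).congr_deriv ?_
        rw [locDiv, if_neg h1, if_pos h0, genConj, if_pos h0, Real.log_div hq.ne' hp0.ne', hp,
          Real.log_mul hq.ne' hE.ne']
        field_simp
        ring
      · have hs : expR s y ≠ 0 ∨ 1 < s := by
          by_cases hz : expQ (2 - s) y = 0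
          · exact Or.inr (expQ_eq_zero hz).1
          · exact Or.inl (ENNReal.toReal_pos hz ht).ne'
        have hd := (((hA.const_mul s).add (hB.const_mul (1 - s))).sub
          ((hA.rpow_const (p := s) (by
            rcases hs with hs | hs
            · left; rw [hp]; simpa using ⟨hq.ne', hs⟩
            · right; exact hs.le)).mul
          (hB.rpow_const (p := 1 - s) (Or.inl (by simpa using hq.ne'))))).div_const (s * (1 - s))
        have heq : (fun ε : ℝ => locDiv s ((1 - ε * τ) * p) ((1 - ε) * q)) =
            fun ε : ℝ => (s * ((1 - ε * τ) * p) + (1 - s) * ((1 - ε) * q) -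
              ((1 - ε * τ) * p) ^ s * ((1 - ε) * q) ^ (1 - s)) / (s * (1 - s)) := by
          funext ε; rw [locDiv, if_neg h1, if_neg h0]
        rw [heq]
        refine hd.congr_deriv ?_
        have h3 : 1 - s ≠ 0 := sub_ne_zero.mpr (Ne.symm h1)
        simp only [zero_mul, sub_zero, one_mul]
        rw [locDiv, if_neg h1, if_neg h0, genConj, if_neg h0]
        -- `p` may vanish here when `s > 1`; the identity survives because `s ≠ 0`.
        have e1 : p * p ^ (s - 1) = p ^ s := by
          by_cases hp0 : p = 0
          · rw [hp0, Real.zero_rpow h0, zero_mul]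
          · rw [Real.rpow_sub_one hp0]; field_simp
        have e2 : q * q ^ (1 - s - 1) = q ^ (1 - s) := by
          rw [Real.rpow_sub_one hq.ne']; field_simp
        have e3 : p ^ s * q ^ (1 - s) = q * expR s y ^ s := by
          rw [hp, Real.mul_rpow hq.le hE0, mul_right_comm, ← Real.rpow_add hq]
          simp
        have e4 : -τ * p * s * p ^ (s - 1) * q ^ (1 - s) +
            p ^ s * (-q * (1 - s) * q ^ (1 - s - 1)) =
            (-τ * s - (1 - s)) * (q * expR s y ^ s) := by
          linear_combination (-τ * s * q ^ (1 - s)) * e1 - (1 - s) * p ^ s * e2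
            + (-τ * s - (1 - s)) * e3
        rw [e4, e3]
        field_simp
        ring

theorem expR_nonneg (s y : ℝ) : 0 ≤ expR s y := ENNReal.toReal_nonneg

/-- The index `s = (1 - α) / 2`. -/
def idx (α : ℝ) : ℝ := (1 - α) / 2

theorem qOf_eq (α : ℝ) : qOf α = 2 - idx α := by unfold qOf idx; ring

theorem coe_sum_ereal {ι : Type*} (t : Finset ι) (f : ι → ℝ) :
    ((∑ i ∈ t, f i : ℝ) : EReal) = ∑ i ∈ t, (f i : EReal) := by
  classical
  induction t using Finset.induction_on with
  | empty => simp
  | insert i t hi ih => rw [Finset.sum_insert hi, Finset.sum_insert hi, EReal.coe_add, ih]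

theorem sum_ne_bot_ereal {ι : Type*} (t : Finset ι) (f : ι → EReal) (hf : ∀ i ∈ t, f i ≠ ⊥) :
    ∑ i ∈ t, f i ≠ ⊥ := by
  classical
  induction t using Finset.induction_on with
  | empty => simp
  | insert i t hi ih =>
    rw [Finset.sum_insert hi]
    exact EReal.add_ne_bot_iff.mpr ⟨hf i (Finset.mem_insert_self i t),
      ih fun j hj => hf j (Finset.mem_insert_of_mem hj)⟩

theorem sum_eq_top_ereal {ι : Type*} [Fintype ι] (f : ι → EReal) (hf : ∀ i, f i ≠ ⊥) (i : ι)
    (hi : f i = ⊤) : ∑ i, f i = ⊤ := by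
  classical
  rw [← Finset.add_sum_erase _ _ (Finset.mem_univ i), hi]
  exact EReal.top_add_of_ne_bot (sum_ne_bot_ereal _ _ fun j _ => hf j)

/-! ### The `α`-divergence as a sum of local divergences. -/

section Divergence

variable {A : Type*} [Fintype A]

theorem coe_mul_log_div {p q : ℝ} (hp : 0 ≤ p) (hq : 0 ≤ q) (h : q = 0 → p = 0) :
    (p : EReal) * ENNReal.log (ENNReal.ofReal p / ENNReal.ofReal q) =
      ((p * Real.log (p / q) : ℝ) : EReal) := by
  rcases hp.eq_or_lt with rfl | hp
  · simp
  · have hq : 0 < q := lt_of_le_of_ne hq fun h' => hp.ne' (h h'.symm)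
    rw [← ENNReal.ofReal_div_of_pos hq, ENNReal.log_ofReal_of_pos (div_pos hp hq), EReal.coe_mul]

theorem coe_mul_log_div_ne_bot {p q : ℝ} (hp : 0 ≤ p) (hq : 0 ≤ q) :
    (p : EReal) * ENNReal.log (ENNReal.ofReal p / ENNReal.ofReal q) ≠ ⊥ := by
  by_cases h : q = 0 → p = 0
  · rw [coe_mul_log_div hp hq h]; exact EReal.coe_ne_bot _
  · push Not at h
    have hp := lt_of_le_of_ne hp h.2.symm
    rw [h.1, ENNReal.ofReal_zero, ENNReal.div_zero (ENNReal.ofReal_pos.mpr hp).ne',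
      ENNReal.log_top, EReal.coe_mul_top_of_pos hp]
    exact top_ne_bot

theorem sum_coe_mul_log_eq_top {p q : A → ℝ} (hp : p ∈ stdSimplex ℝ A) (hq : q ∈ stdSimplex ℝ A)
    (h : ¬ ∀ a, q a = 0 → p a = 0) :
    ∑ a, (p a : EReal) * ENNReal.log (ENNReal.ofReal (p a) / ENNReal.ofReal (q a)) = ⊤ := by
  push Not at h
  obtain ⟨a, h1, h2⟩ := h
  refine sum_eq_top_ereal _ (fun a => coe_mul_log_div_ne_bot (hp.1 a) (hq.1 a)) a ?_
  have hp := lt_of_le_of_ne (hp.1 a) h2.symm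
  rw [h1, ENNReal.ofReal_zero, ENNReal.div_zero (ENNReal.ofReal_pos.mpr hp).ne',
    ENNReal.log_top, EReal.coe_mul_top_of_pos hp]

/-- Extended and real powers differ only for `0` to a negative exponent. `LocFin` then makes the
other factor a positive power of `0`, so both products vanish. -/
theorem ofReal_rpow_mul_rpow {s p q : ℝ} (h0 : s ≠ 0) (h1 : s ≠ 1) (hp : 0 ≤ p) (hq : 0 ≤ q)
    (hf : LocFin s p q) :
    ENNReal.ofReal p ^ s * ENNReal.ofReal q ^ (1 - s) = ENNReal.ofReal (p ^ s * q ^ (1 - s)) := by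
  have h3 : 1 - s ≠ 0 := sub_ne_zero.mpr (Ne.symm h1)
  rcases hp.eq_or_lt with rfl | hp
  · rw [Real.zero_rpow h0, zero_mul, ENNReal.ofReal_zero]
    rcases lt_or_gt_of_ne h0 with h | h
    · rw [hf.2 h.le rfl, ENNReal.ofReal_zero, ENNReal.zero_rpow_of_pos (y := 1 - s) (by linarith),
        mul_zero]
    · rw [ENNReal.zero_rpow_of_pos h, zero_mul]
  · rcases hq.eq_or_lt with rfl | hq
    · rw [Real.zero_rpow h3, mul_zero, ENNReal.ofReal_zero]
      have : s < 1 := by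
        by_contra h
        exact hp.ne' (hf.1 (not_lt.mp h) rfl)
      rw [ENNReal.zero_rpow_of_pos (y := 1 - s) (by linarith), mul_zero]
    · rw [ENNReal.ofReal_rpow_of_pos hp, ENNReal.ofReal_rpow_of_pos hq,
        ENNReal.ofReal_mul (by positivity)]

/-- The affine terms that normalize the generator cancel because both vectors have total mass `1`.
-/
theorem alphaDiv_eq_coe (α : ℝ) {p q : A → ℝ} (hp : p ∈ stdSimplex ℝ A) (hq : q ∈ stdSimplex ℝ A)
    (hf : ∀ a, LocFin (idx α) (p a) (q a)) :
    alphaDiv α p q = ((∑ a, locDiv (idx α) (p a) (q a) : ℝ) : EReal) := by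
  unfold alphaDiv
  split_ifs with h1 h0
  · have hs : idx α = 1 := by rw [h1]; norm_num [idx]
    rw [hs] at hf ⊢
    simp only [locDiv, if_true]
    rw [Finset.sum_add_distrib, Finset.sum_sub_distrib, hp.2, hq.2, sub_add_cancel, coe_sum_ereal]
    exact Finset.sum_congr rfl fun a _ => coe_mul_log_div (hp.1 a) (hq.1 a) ((hf a).1 le_rfl)
  · have hs : idx α = 0 := by rw [h0]; norm_num [idx]
    rw [hs] at hf ⊢
    simp only [locDiv, if_true, zero_ne_one, if_false]
    rw [Finset.sum_add_distrib, Finset.sum_sub_distrib, hp.2, hq.2, sub_add_cancel, coe_sum_ereal]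
    exact Finset.sum_congr rfl fun a _ => coe_mul_log_div (hq.1 a) (hp.1 a) ((hf a).2 le_rfl)
  · have h3 : idx α ≠ 1 := fun h => h1 (by unfold idx at h; linarith)
    have h4 : idx α ≠ 0 := fun h => h0 (by unfold idx at h; linarith)
    have e1 : (1 + α) / 2 = 1 - idx α := by unfold idx; ring
    have e2 : 4 / (1 - α ^ 2) = 1 / (idx α * (1 - idx α)) := by
      rw [show idx α * (1 - idx α) = (1 - α ^ 2) / 4 by unfold idx; ring, one_div_div]
    rw [e1, e2]
    change _ * (1 - ((∑ a, ENNReal.ofReal (p a) ^ idx α * _ : ℝ≥0∞) : EReal)) = _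
    rw [Finset.sum_congr rfl fun a _ => ofReal_rpow_mul_rpow h4 h3 (hp.1 a) (hq.1 a) (hf a),
      ← ENNReal.ofReal_sum_of_nonneg fun a _ => mul_nonneg (Real.rpow_nonneg (hp.1 a) _)
        (Real.rpow_nonneg (hq.1 a) _), EReal.coe_ennreal_ofReal, max_eq_left
      (Finset.sum_nonneg fun a _ => mul_nonneg (Real.rpow_nonneg (hp.1 a) _)
        (Real.rpow_nonneg (hq.1 a) _))]
    rw [← EReal.coe_one, ← EReal.coe_sub, ← EReal.coe_mul]
    congr 1
    simp only [locDiv, if_neg h3, if_neg h4]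
    rw [← Finset.sum_div, Finset.sum_sub_distrib, Finset.sum_add_distrib, ← Finset.mul_sum,
      ← Finset.mul_sum, hp.2, hq.2]
    ring

/-- Apart from the two logarithmic cases, an infinite term requires `s > 1` or `s < 0`; then the
factor `1 / (s * (1 - s))` is negative and multiplies `1 - ∞`. -/
theorem alphaDiv_eq_top (α : ℝ) {p q : A → ℝ} (hp : p ∈ stdSimplex ℝ A) (hq : q ∈ stdSimplex ℝ A)
    (hf : ¬ ∀ a, LocFin (idx α) (p a) (q a)) : alphaDiv α p q = ⊤ := by
  unfold alphaDiv
  split_ifs with h1 h0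
  · have hs : idx α = 1 := by rw [h1]; norm_num [idx]
    refine sum_coe_mul_log_eq_top hp hq fun h => hf fun a => ⟨fun _ => h a, fun h' => ?_⟩
    rw [hs] at h'; norm_num at h'
  · have hs : idx α = 0 := by rw [h0]; norm_num [idx]
    refine sum_coe_mul_log_eq_top hq hp fun h => hf fun a => ⟨fun h' => ?_, fun _ => h a⟩
    rw [hs] at h'; norm_num at h'
  · have h3 : idx α ≠ 1 := fun h => h1 (by unfold idx at h; linarith)
    have h4 : idx α ≠ 0 := fun h => h0 (by unfold idx at h; linarith)
    have e1 : (1 + α) / 2 = 1 - idx α := by unfold idx; ring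
    have e2 : 4 / (1 - α ^ 2) = 1 / (idx α * (1 - idx α)) := by
      rw [show idx α * (1 - idx α) = (1 - α ^ 2) / 4 by unfold idx; ring, one_div_div]
    rw [e1, e2]
    change _ * (1 - ((∑ a, ENNReal.ofReal (p a) ^ idx α * _ : ℝ≥0∞) : EReal)) = _
    simp only [not_forall] at hf
    obtain ⟨a, ha⟩ := hf
    unfold LocFin at ha
    have key : idx α * (1 - idx α) < 0 ∧
        ENNReal.ofReal (p a) ^ idx α * ENNReal.ofReal (q a) ^ (1 - idx α) = ∞ := by
      rw [not_and_or] at ha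
      push Not at ha
      rcases ha with ⟨h, hq0, hp0⟩ | ⟨h, hp0, hq0⟩
      · have h : 1 < idx α := lt_of_le_of_ne h (Ne.symm h3)
        have hp0 := ENNReal.ofReal_pos.mpr (lt_of_le_of_ne (hp.1 a) hp0.symm)
        refine ⟨by nlinarith, ?_⟩
        rw [hq0, ENNReal.ofReal_zero, ENNReal.zero_rpow_of_neg (by linarith), ENNReal.mul_top]
        exact (ENNReal.rpow_pos hp0 ENNReal.ofReal_ne_top).ne'
      · have h : idx α < 0 := lt_of_le_of_ne h h4
        have hq0 := ENNReal.ofReal_pos.mpr (lt_of_le_of_ne (hq.1 a) hq0.symm)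
        refine ⟨by nlinarith, ?_⟩
        rw [hp0, ENNReal.ofReal_zero, ENNReal.zero_rpow_of_neg h, ENNReal.top_mul]
        exact (ENNReal.rpow_pos hq0 ENNReal.ofReal_ne_top).ne'
    have hsum : ∑ a, ENNReal.ofReal (p a) ^ idx α * ENNReal.ofReal (q a) ^ (1 - idx α) = ∞ :=
      ENNReal.sum_eq_top.mpr ⟨a, Finset.mem_univ a, key.2⟩
    rw [hsum, EReal.coe_ennreal_top, EReal.sub_top,
      EReal.coe_mul_bot_of_neg (one_div_neg.mpr key.1)]

theorem locDiv_nonneg {s p q : ℝ} (hp : 0 ≤ p) (hq : 0 ≤ q) (hf : LocFin s p q) :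
    0 ≤ locDiv s p q := by
  have h0 : expQ (2 - s) 0 = 1 := expQ_zero _
  have := fenchel (y := 0) hp hq hf (by simp) (Or.inr (Or.inl (by simp [h0])))
  simpa [genConj, expR, h0] using this

theorem stateObjective_eq_coe (α κ : ℝ) (v : A → ℝ) {p q : A → ℝ} (hp : p ∈ stdSimplex ℝ A)
    (hq : q ∈ stdSimplex ℝ A) (hf : ∀ a, LocFin (idx α) (p a) (q a)) :
    stateObjective α κ v q p =
      ((∑ a, p a * v a - κ * ∑ a, locDiv (idx α) (p a) (q a) : ℝ) : EReal) := by
  rw [stateObjective, alphaDiv_eq_coe α hp hq hf, ← EReal.coe_mul, ← EReal.coe_sub]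

theorem stateObjective_eq_bot (α : ℝ) {κ : ℝ} (hκ : 0 < κ) (v : A → ℝ) {p q : A → ℝ}
    (hp : p ∈ stdSimplex ℝ A) (hq : q ∈ stdSimplex ℝ A)
    (hf : ¬ ∀ a, LocFin (idx α) (p a) (q a)) : stateObjective α κ v q p = ⊥ := by
  rw [stateObjective, alphaDiv_eq_top α hp hq hf, EReal.coe_mul_top_of_pos hκ, EReal.sub_top]

/-! ### Duality for the problem at a single state. -/

/-- Upper bound on the net payoff at a state by the dual value at the multiplier `l`. -/
theorem net_payoff_le {s κ : ℝ} (hκ : 0 < κ) (v : A → ℝ) (l : ℝ) {p n : A → ℝ}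
    (hp : p ∈ stdSimplex ℝ A) (hn : n ∈ stdSimplex ℝ A) (hf : ∀ a, LocFin s (p a) (n a))
    (hd : s < 1 → ∀ a, 0 ≤ 1 + (s - 1) * ((v a - l) / κ))
    (hy : ∀ a, n a = 0 ∨ expQ (2 - s) ((v a - l) / κ) ≠ ∞ ∨ s < 0) :
    ∑ a, p a * v a - κ * ∑ a, locDiv s (p a) (n a) ≤
      l + κ * ∑ a, n a * genConj s ((v a - l) / κ) := by
  have h1 : ∑ a, p a * ((v a - l) / κ) ≤
      ∑ a, (locDiv s (p a) (n a) + n a * genConj s ((v a - l) / κ)) :=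
    Finset.sum_le_sum fun a _ => fenchel (hp.1 a) (hn.1 a) (hf a) (fun h => hd h a) (hy a)
  have h2 : κ * ∑ a, p a * ((v a - l) / κ) = ∑ a, p a * v a - l := by
    rw [Finset.mul_sum]
    have : ∀ a, κ * (p a * ((v a - l) / κ)) = p a * v a - p a * l := fun a => by
      field_simp
    rw [Finset.sum_congr rfl fun a _ => this a, Finset.sum_sub_distrib, ← Finset.sum_mul, hp.2,
      one_mul]
  rw [Finset.sum_add_distrib] at h1
  have h3 := mul_le_mul_of_nonneg_left h1 hκ.le
  rw [mul_add] at h3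
  linarith

/-- The dual bound is attained when Fenchel's inequality is an equality at every action. -/
theorem net_payoff_eq {s κ : ℝ} (hκ : 0 < κ) (v : A → ℝ) (l : ℝ) {p n : A → ℝ}
    (hp : p ∈ stdSimplex ℝ A)
    (h : ∀ a, p a * ((v a - l) / κ) = locDiv s (p a) (n a) + n a * genConj s ((v a - l) / κ)) :
    ∑ a, p a * v a - κ * ∑ a, locDiv s (p a) (n a) =
      l + κ * ∑ a, n a * genConj s ((v a - l) / κ) := by
  have h1 : ∑ a, p a * ((v a - l) / κ) =
      ∑ a, (locDiv s (p a) (n a) + n a * genConj s ((v a - l) / κ)) :=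
    Finset.sum_congr rfl fun a _ => h a
  have h2 : κ * ∑ a, p a * ((v a - l) / κ) = ∑ a, p a * v a - l := by
    rw [Finset.mul_sum]
    have : ∀ a, κ * (p a * ((v a - l) / κ)) = p a * v a - p a * l := fun a => by
      field_simp
    rw [Finset.sum_congr rfl fun a _ => this a, Finset.sum_sub_distrib, ← Finset.sum_mul, hp.2,
      one_mul]
  rw [Finset.sum_add_distrib] at h1
  have h3 := congrArg (κ * ·) h1
  simp only [mul_add] at h3
  linarith

/-- The multiplier is the one of the support: the solution is the `q`-exponential of `m`. -/
def Inner (α κ : ℝ) (v m : A → ℝ) : Prop :=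
  (α ≤ -1 ∨ Function.support m = Set.univ) ∨ lamZero α κ v m ≤ lamBar α κ v m

theorem stateConstant_of_inner {α κ : ℝ} {v m : A → ℝ} (h : Inner α κ v m) :
    stateConstant α κ v m = lamBar α κ v m := by
  unfold stateConstant
  split_ifs with h1 h2
  · rfl
  · rfl
  · exact absurd h (not_or.mpr ⟨h1, h2⟩)

theorem stateConstant_of_not_inner {α κ : ℝ} {v m : A → ℝ} (h : ¬ Inner α κ v m) :
    stateConstant α κ v m = lamZero α κ v m := by
  have := not_or.mp h
  rw [stateConstant, if_neg this.1, if_neg this.2]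

theorem lamBar_le_stateConstant (α κ : ℝ) (v m : A → ℝ) :
    lamBar α κ v m ≤ stateConstant α κ v m := by
  by_cases h : Inner α κ v m
  · rw [stateConstant_of_inner h]
  · rw [stateConstant_of_not_inner h]
    exact (not_le.mp (not_or.mp h).2).le

theorem lamZero_le_stateConstant {α κ : ℝ} {v m : A → ℝ} (hα : -1 < α)
    (hm : Function.support m ≠ Set.univ) : lamZero α κ v m ≤ stateConstant α κ v m := by
  by_cases h : Inner α κ v m
  · rw [stateConstant_of_inner h]
    exact h.resolve_left (not_or.mpr ⟨not_le.mpr hα, hm⟩)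
  · rw [stateConstant_of_not_inner h]

theorem le_outsideMax (v m : A → ℝ) {a : A} (ha : m a = 0) : v a ≤ outsideMax v m :=
  le_ciSup (f := fun a : {a : A // a ∉ Function.support m} => v a) (Set.finite_range _).bddAbove
    ⟨a, by simpa using ha⟩

theorem exists_outsideMax {v m : A → ℝ} (hm : Function.support m ≠ Set.univ) :
    ∃ a, m a = 0 ∧ v a = outsideMax v m := by
  obtain ⟨b, hb⟩ := (Set.ne_univ_iff_exists_notMem _).mp hm
  have : Nonempty {a : A // a ∉ Function.support m} := ⟨⟨b, hb⟩⟩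
  obtain ⟨a, ha⟩ := exists_eq_ciSup_of_finite
    (f := fun a : {a : A // a ∉ Function.support m} => v a)
  exact ⟨a, by simpa using a.2, ha⟩

/-- At `lamBar` the terms sum to `1`, so each is finite; a larger multiplier only lowers the
exponential. -/
theorem expQ_ne_top_of_support {α κ : ℝ} (hκ : 0 < κ) (v : A → ℝ) {m : A → ℝ}
    (hm : m ∈ stdSimplex ℝ A) {l : ℝ} (hl : lamBar α κ v m ≤ l) {a : A} (ha : 0 < m a) :
    expQ (2 - idx α) ((v a - l) / κ) ≠ ∞ := by
  have h1 := normSum_lamBar α hκ v hm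
  rw [normSum, qOf_eq] at h1
  have h2 := ENNReal.sum_ne_top.mp (by rw [h1]; exact ENNReal.one_ne_top) a (Finset.mem_univ a)
  have h3 : expQ (2 - idx α) ((v a - lamBar α κ v m) / κ) ≠ ∞ := fun h => h2 (by
    rw [h, ENNReal.mul_top (ENNReal.ofReal_pos.mpr ha).ne'])
  refine ne_top_of_le_ne_top h3 (expQ_mono _ ?_)
  gcongr

/-- Dual feasibility of the constant: on the support it follows from finiteness of the exponential,
off the support from `lamZero ≤ stateConstant`. -/
theorem bracket_nonneg {α κ : ℝ} (hκ : 0 < κ) (v : A → ℝ) {m : A → ℝ}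
    (hm : m ∈ stdSimplex ℝ A) (h : idx α < 1) (a : A) :
    0 ≤ 1 + (idx α - 1) * ((v a - stateConstant α κ v m) / κ) := by
  by_cases ha : m a = 0
  · have hα : -1 < α := by unfold idx at h; linarith
    have h1 := lamZero_le_stateConstant (κ := κ) (v := v) (m := m) hα
      (fun hu => by have : a ∈ Function.support m := hu ▸ Set.mem_univ a
                    exact this ha)
    have h2 := le_outsideMax v m ha
    unfold lamZero at h1
    have h3 : (v a - stateConstant α κ v m) / κ ≤ 2 / (1 + α) := by
      rw [div_le_iff₀ hκ]
      have : 2 / (1 + α) * κ = 2 * κ / (1 + α) := by ring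
      linarith
    have h4 : (1 + α) * (2 / (1 + α)) = 2 := mul_div_cancel₀ _ (by linarith)
    have h5 : idx α - 1 = -((1 + α) / 2) := by unfold idx; ring
    rw [h5]
    nlinarith
  · by_contra hcon
    exact expQ_ne_top_of_support hκ v hm (lamBar_le_stateConstant α κ v m)
      (lt_of_le_of_ne (hm.1 a) (Ne.symm ha)) (expQ_eq_top.mpr ⟨h, (not_le.mp hcon).le⟩)

theorem ofReal_eq_mul_expQ_iff {s p q y : ℝ} (hp : 0 ≤ p) (hq : 0 < q)
    (ht : expQ (2 - s) y ≠ ∞) :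
    ENNReal.ofReal p = ENNReal.ofReal q * expQ (2 - s) y ↔ p = q * expR s y := by
  have : ENNReal.ofReal q * expQ (2 - s) y = ENNReal.ofReal (q * expR s y) := by
    rw [ENNReal.ofReal_mul hq.le, expR, ENNReal.ofReal_toReal ht]
  rw [this, ENNReal.ofReal_eq_ofReal_iff hp (mul_nonneg hq.le (expR_nonneg _ _))]

theorem isQExponential_iff {α κ : ℝ} (hκ : 0 < κ) (v : A → ℝ) {m p : A → ℝ}
    (hm : m ∈ stdSimplex ℝ A) (hp : p ∈ stdSimplex ℝ A) :
    IsQExponential α κ v m p ↔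
      (∀ a, 0 < m a → p a = m a * expR (idx α) ((v a - stateConstant α κ v m) / κ)) ∧
      ∀ a, m a = 0 → p a = 0 ∨ (¬ Inner α κ v m ∧ v a = outsideMax v m) := by
  have hfin := fun a (ha : 0 < m a) =>
    expQ_ne_top_of_support hκ v hm (lamBar_le_stateConstant α κ v m) ha
  unfold IsQExponential
  rw [qOf_eq]
  by_cases hI : Inner α κ v m
  · rw [if_pos (by exact hI), ← stateConstant_of_inner hI]
    refine ⟨fun h => ⟨fun a ha => (ofReal_eq_mul_expQ_iff (hp.1 a) ha (hfin a ha)).mp (h a),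
      fun a ha => Or.inl ?_⟩, fun h a => ?_⟩
    · have := h a
      rw [ha, ENNReal.ofReal_zero, zero_mul, ENNReal.ofReal_eq_zero] at this
      exact le_antisymm this (hp.1 a)
    · by_cases ha : m a = 0
      · rw [ha, (h.2 a ha).resolve_right (fun h' => h'.1 hI)]; simp
      · have ha := lt_of_le_of_ne (hm.1 a) (Ne.symm ha)
        exact (ofReal_eq_mul_expQ_iff (hp.1 a) ha (hfin a ha)).mpr (h.1 a ha)
  · rw [if_neg (by exact hI), ← stateConstant_of_not_inner hI]
    refine and_congr (forall_congr' fun a => ?_) (forall_congr' fun a => ?_)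
    · have : a ∈ Function.support m ↔ 0 < m a :=
        ⟨fun h => lt_of_le_of_ne (hm.1 a) (Ne.symm h), fun h => h.ne'⟩
      rw [this]
      exact forall_congr' fun ha => ofReal_eq_mul_expQ_iff (hp.1 a) ha (hfin a ha)
    · rw [Function.notMem_support]
      refine forall_congr' fun ha => ?_
      have h1 := le_outsideMax v m ha
      constructor
      · intro h
        rcases h1.lt_or_eq with h2 | h2
        · exact Or.inl (h h2)
        · exact Or.inr ⟨hI, h2⟩
      · rintro (h | h) h2
        · exact h
        · exact absurd h.2 h2.ne

/-- Complementary slackness. Mass outside the support of `m` sits only where the normalized payoff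
equals the recession slope, so there the Fenchel equality is linear in `p a`. -/
theorem qExponential_fenchel_eq {α κ : ℝ} (hκ : 0 < κ) (v : A → ℝ) {m p : A → ℝ}
    (hm : m ∈ stdSimplex ℝ A) (hp : p ∈ stdSimplex ℝ A) (h : IsQExponential α κ v m p) (a : A) :
    LocFin (idx α) (p a) (m a) ∧
      p a * ((v a - stateConstant α κ v m) / κ) = locDiv (idx α) (p a) (m a) +
        m a * genConj (idx α) ((v a - stateConstant α κ v m) / κ) := by
  rw [isQExponential_iff hκ v hm hp] at h
  by_cases ha : m a = 0
  · rcases h.2 a ha with h1 | ⟨h1, h2⟩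
    · rw [h1, ha, locDiv_self _ _ le_rfl]
      exact ⟨⟨fun _ _ => rfl, fun _ _ => rfl⟩, by simp⟩
    · have hα : -1 < α := not_le.mp (not_or.mp (not_or.mp h1).1).1
      have hs : idx α < 1 := by unfold idx; linarith
      have hf : LocFin (idx α) (p a) 0 := ⟨fun h => absurd h hs.not_ge, fun _ _ => rfl⟩
      rw [ha]
      refine ⟨hf, ?_⟩
      rw [stateConstant_of_not_inner h1, lamZero, h2, zero_mul, add_zero]
      have e1 : 1 - idx α = (1 + α) / 2 := by unfold idx; ring
      have e2 : 1 + α ≠ 0 := by linarith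
      rcases locDiv_zero_right hf with ⟨_, h'⟩ | ⟨h', h''⟩
      · rw [h', e1]; field_simp; ring
      · rw [h'', h', zero_mul]
  · have ha := lt_of_le_of_ne (hm.1 a) (Ne.symm ha)
    have ht := expQ_ne_top_of_support hκ v hm (lamBar_le_stateConstant α κ v m) ha
    rw [h.1 a ha]
    exact ⟨locFin_mul_expR ha ht, fenchel_eq ha ht⟩

/-- Raising the multiplier above `lamBar` can only remove mass from the support; the deficit is what
the best outside actions receive. -/
theorem sum_mul_expR_le_one {α κ : ℝ} (hκ : 0 < κ) (v : A → ℝ) {m : A → ℝ}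
    (hm : m ∈ stdSimplex ℝ A) :
    ∑ a, m a * expR (idx α) ((v a - stateConstant α κ v m) / κ) ≤ 1 ∧
    (Inner α κ v m → ∑ a, m a * expR (idx α) ((v a - stateConstant α κ v m) / κ) = 1) := by
  have key : ∀ l, lamBar α κ v m ≤ l →
      ENNReal.ofReal (∑ a, m a * expR (idx α) ((v a - l) / κ)) = normSum α κ v m l := by
    intro l hl
    rw [ENNReal.ofReal_sum_of_nonneg fun a _ => mul_nonneg (hm.1 a) (expR_nonneg _ _),
      normSum, qOf_eq]
    refine Finset.sum_congr rfl fun a _ => ?_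
    by_cases ha : m a = 0
    · simp [ha]
    · have ha := lt_of_le_of_ne (hm.1 a) (Ne.symm ha)
      exact (ofReal_eq_mul_expQ_iff (mul_nonneg (hm.1 a) (expR_nonneg _ _)) ha
        (expQ_ne_top_of_support hκ v hm hl ha)).mpr rfl
  have h1 := key _ (lamBar_le_stateConstant α κ v m)
  constructor
  · rw [← ENNReal.ofReal_le_one, h1, ← normSum_lamBar α hκ v hm]
    refine Finset.sum_le_sum fun a _ => mul_le_mul_right (expQ_mono _ ?_) _
    have := lamBar_le_stateConstant α κ v m
    gcongr
  · intro hI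
    rw [← ENNReal.ofReal_eq_one, h1, stateConstant_of_inner hI, normSum_lamBar α hκ v hm]

theorem exists_isQExponential (α : ℝ) {κ : ℝ} (hκ : 0 < κ) (v : A → ℝ) {m : A → ℝ}
    (hm : m ∈ stdSimplex ℝ A) : ∃ p ∈ stdSimplex ℝ A, IsQExponential α κ v m p := by
  classical
  obtain ⟨h1, h2⟩ := sum_mul_expR_le_one (α := α) hκ v hm
  set w : A → ℝ := fun a => m a * expR (idx α) ((v a - stateConstant α κ v m) / κ) with hw
  have hw0 : ∀ a, 0 ≤ w a := fun a => mul_nonneg (hm.1 a) (expR_nonneg _ _)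
  by_cases hI : Inner α κ v m
  · have hp : w ∈ stdSimplex ℝ A := ⟨hw0, h2 hI⟩
    refine ⟨w, hp, (isQExponential_iff hκ v hm hp).mpr ⟨fun a _ => rfl, fun a ha => Or.inl ?_⟩⟩
    simp [hw, ha]
  · obtain ⟨b, hb, hb'⟩ := exists_outsideMax (v := v) (m := m) (not_or.mp (not_or.mp hI).1).2
    -- All the leftover mass goes to one best outside action `b`.
    have hp : (fun a => w a + if a = b then 1 - ∑ c, w c else 0) ∈ stdSimplex ℝ A := by
      refine ⟨fun a => add_nonneg (hw0 a) ?_, ?_⟩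
      · split_ifs
        · linarith
        · exact le_rfl
      · rw [Finset.sum_add_distrib, Finset.sum_ite_eq' Finset.univ b]
        simp
    refine ⟨_, hp, (isQExponential_iff hκ v hm hp).mpr ⟨fun a ha => ?_, fun a ha => ?_⟩⟩
    · rw [if_neg (by rintro rfl; exact ha.ne' hb), add_zero]
    · by_cases hab : a = b
      · exact Or.inr ⟨hI, hab ▸ hb'⟩
      · left; simp [hab, hw, ha]

/-- Every `q`-exponential vector attains the dual bound, and one exists. Hence a solution attains it
too, and equality of the sums forces equality in each Fenchel term. -/
theorem isStateSolution_iff (α : ℝ) {κ : ℝ} (hκ : 0 < κ) (v : A → ℝ) {m p : A → ℝ}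
    (hm : m ∈ stdSimplex ℝ A) (hp : p ∈ stdSimplex ℝ A) :
    IsStateSolution α κ v m p ↔ IsQExponential α κ v m p := by
  set l := stateConstant α κ v m with hl
  have hd : idx α < 1 → ∀ a, 0 ≤ 1 + (idx α - 1) * ((v a - l) / κ) :=
    fun h a => bracket_nonneg hκ v hm h a
  have ht : ∀ a, 0 < m a → expQ (2 - idx α) ((v a - l) / κ) ≠ ∞ := fun a ha =>
    expQ_ne_top_of_support hκ v hm (lamBar_le_stateConstant α κ v m) ha
  have hy : ∀ a, m a = 0 ∨ expQ (2 - idx α) ((v a - l) / κ) ≠ ∞ ∨ idx α < 0 := fun a => by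
    rcases (hm.1 a).eq_or_lt with h | h
    · exact Or.inl h.symm
    · exact Or.inr (Or.inl (ht a h))
  have hval : ∀ p' ∈ stdSimplex ℝ A, IsQExponential α κ v m p' → stateObjective α κ v m p' =
      ((l + κ * ∑ a, m a * genConj (idx α) ((v a - l) / κ) : ℝ) : EReal) := by
    intro p' hp' h
    rw [stateObjective_eq_coe α κ v hp' hm fun a => (qExponential_fenchel_eq hκ v hm hp' h a).1,
      net_payoff_eq hκ v l hp' fun a => (qExponential_fenchel_eq hκ v hm hp' h a).2]
  constructor
  · intro h
    obtain ⟨p', hp', h'⟩ := exists_isQExponential α hκ v hm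
    have h1 := h.2 p' hp'
    rw [hval p' hp' h'] at h1
    by_cases hf : ∀ a, LocFin (idx α) (p a) (m a)
    · rw [stateObjective_eq_coe α κ v hp hm hf, EReal.coe_le_coe_iff] at h1
      have hle : ∀ a ∈ Finset.univ, p a * ((v a - l) / κ) ≤
          locDiv (idx α) (p a) (m a) + m a * genConj (idx α) ((v a - l) / κ) :=
        fun a _ => fenchel (hp.1 a) (hm.1 a) (hf a) (fun h => hd h a) (hy a)
      have hsum : ∑ a, p a * ((v a - l) / κ) =
          ∑ a, (locDiv (idx α) (p a) (m a) + m a * genConj (idx α) ((v a - l) / κ)) := by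
        refine le_antisymm (Finset.sum_le_sum hle) ?_
        have h2 : κ * ∑ a, p a * ((v a - l) / κ) = ∑ a, p a * v a - l := by
          rw [Finset.mul_sum]
          have : ∀ a, κ * (p a * ((v a - l) / κ)) = p a * v a - p a * l := fun a => by
            field_simp
          rw [Finset.sum_congr rfl fun a _ => this a, Finset.sum_sub_distrib, ← Finset.sum_mul,
            hp.2, one_mul]
        rw [Finset.sum_add_distrib]
        refine le_of_mul_le_mul_left ?_ hκ
        rw [h2, mul_add]
        linarith
      have heq := fun a => (Finset.sum_eq_sum_iff_of_le hle).mp hsum a (Finset.mem_univ a)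
      have hS : ∀ a, 0 < m a → p a = m a * expR (idx α) ((v a - l) / κ) := fun a ha =>
        eq_of_fenchel_eq (hp.1 a) ha (hf a) (ht a ha) (heq a)
      rw [isQExponential_iff hκ v hm hp]
      refine ⟨hS, fun a ha => ?_⟩
      by_cases hI : Inner α κ v m
      -- The `q`-exponential on the support already has mass `1`, so nothing remains outside.
      · left
        have h3 := (sum_mul_expR_le_one (α := α) hκ v hm).2 hI
        have h4 : ∑ a, m a * expR (idx α) ((v a - l) / κ) = ∑ a, p a := by rw [h3, hp.2]
        have h5 : ∀ a ∈ Finset.univ, m a * expR (idx α) ((v a - l) / κ) ≤ p a := by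
          intro a _
          rcases (hm.1 a).eq_or_lt with h | h
          · rw [← h, zero_mul]; exact hp.1 a
          · exact (hS a h).ge
        have := (Finset.sum_eq_sum_iff_of_le h5).mp h4 a (Finset.mem_univ a)
        rw [← this, ha, zero_mul]
      · have hα : -1 < α := not_le.mp (not_or.mp (not_or.mp hI).1).1
        have hs : idx α < 1 := by unfold idx; linarith
        have h3 := heq a
        have h4 := hf a
        rw [ha] at h3 h4
        rcases locDiv_zero_right h4 with ⟨_, h'⟩ | ⟨h', -⟩
        · by_cases hpa : p a = 0
          · exact Or.inl hpa
          · refine Or.inr ⟨hI, ?_⟩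
            -- Cancelling `p a ≠ 0` leaves the normalized payoff equal to the recession slope; at
            -- the multiplier `lamZero` this means `v a = outsideMax v m`.
            rw [h', zero_mul, add_zero, div_eq_mul_inv (p a)] at h3
            have h5 := mul_left_cancel₀ hpa h3
            rw [hl, stateConstant_of_not_inner hI, lamZero] at h5
            have e1 : 1 - idx α = (1 + α) / 2 := by unfold idx; ring
            have e2 : 1 + α ≠ 0 := by linarith
            rw [e1, inv_div, div_eq_iff hκ.ne'] at h5
            have : 2 / (1 + α) * κ = 2 * κ / (1 + α) := by ring
            linarith
        · exact Or.inl h'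
    · rw [stateObjective_eq_bot α hκ v hp hm hf, le_bot_iff] at h1
      exact absurd h1 (EReal.coe_ne_bot _)
  · intro h
    refine ⟨hp, fun p' hp' => ?_⟩
    rw [hval p hp h]
    by_cases hf : ∀ a, LocFin (idx α) (p' a) (m a)
    · rw [stateObjective_eq_coe α κ v hp' hm hf, EReal.coe_le_coe_iff]
      exact net_payoff_le hκ v l hp' hm hf hd hy
    · rw [stateObjective_eq_bot α hκ v hp' hm hf]; exact bot_le

end Divergence

/-! ### The `α`-integration as the minimizer in the `α`-information. -/

section Mean

theorem mem_carrier_iff {Θ A : Type*} {α : ℝ} {P : Θ → A → ℝ} {a : A} :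
    a ∈ carrier α P ↔ if α < 1 then ∃ θ, P θ a ≠ 0 else ∀ θ, P θ a ≠ 0 := by
  unfold carrier
  split_ifs
  · simp [unionSupp]
  · simp [commonSupp]

theorem carrier_nonempty {Θ A : Type*} [Fintype A] {α : ℝ} [Nonempty Θ] {P : Θ → A → ℝ} (hP : IsChoiceRule P)
    (h : HasAlphaIntegration α P) : (carrier α P).Nonempty := by
  rcases h with h | ⟨h, h'⟩
  · have θ := Classical.arbitrary Θ
    have : ∑ a, P θ a ≠ 0 := by rw [(hP θ).2]; exact one_ne_zero
    obtain ⟨a, -, ha⟩ := Finset.exists_ne_zero_of_sum_ne_zero this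
    exact ⟨a, mem_carrier_iff.mpr (by rw [if_pos h]; exact ⟨θ, ha⟩)⟩
  · rw [carrier, if_neg h.not_gt]; exact h'

variable {Θ A : Type*} [Fintype Θ]

theorem nonempty_of_mem_stdSimplex {π : Θ → ℝ} (hπ : π ∈ stdSimplex ℝ Θ) : Nonempty Θ := by
  by_contra hcon
  rw [not_nonempty_iff] at hcon
  have := hπ.2
  simp at this

theorem idx_pos_iff {α : ℝ} : 0 < idx α ↔ α < 1 := by
  unfold idx; constructor <;> intro h <;> linarith

theorem idx_eq_zero_iff {α : ℝ} : idx α = 0 ↔ α = 1 := by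
  unfold idx; constructor <;> intro h <;> linarith

/-- For `s < 0` a zero entry has an infinite extended power but real power `0`; the last hypothesis
excludes this. -/
theorem alphaMean_toReal {α : ℝ} (h0 : idx α ≠ 0) (π : Θ → ℝ) (hπ : ∀ θ, 0 ≤ π θ) (x : Θ → ℝ)
    (hx : ∀ θ, 0 ≤ x θ) (h : 0 < idx α ∨ ∀ θ, 0 < x θ) :
    (alphaMean α π fun θ => ENNReal.ofReal (x θ)).toReal =
      (∑ θ, π θ * x θ ^ idx α) ^ (1 / idx α) := by
  have hα : α ≠ 1 := fun h => h0 (idx_eq_zero_iff.mpr h)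
  have h1 : ∀ θ, (π θ : EReal) * AlphaInfo.h α (ENNReal.ofReal (x θ)) =
      ((π θ * x θ ^ idx α : ℝ) : EReal) := by
    intro θ
    have : ENNReal.ofReal (x θ) ^ idx α = ENNReal.ofReal (x θ ^ idx α) := by
      rcases h with h | h
      · exact ENNReal.ofReal_rpow_of_nonneg (hx θ) h.le
      · exact ENNReal.ofReal_rpow_of_pos (h θ)
    rw [AlphaInfo.h, if_neg hα]
    change _ * ((ENNReal.ofReal (x θ) ^ idx α : ℝ≥0∞) : EReal) = _
    rw [this, EReal.coe_ennreal_ofReal, max_eq_left (Real.rpow_nonneg (hx θ) _), EReal.coe_mul]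
  have h2 : 2 / (1 - α) = 1 / idx α := by unfold idx; rw [one_div_div]
  have h3 : 0 ≤ ∑ θ, π θ * x θ ^ idx α :=
    Finset.sum_nonneg fun θ _ => mul_nonneg (hπ θ) (Real.rpow_nonneg (hx θ) _)
  rw [alphaMean, Finset.sum_congr rfl fun θ _ => h1 θ, ← coe_sum_ereal, hInv, if_neg hα,
    EReal.real_coe_toENNReal, h2, ← ENNReal.toReal_rpow, ENNReal.toReal_ofReal h3]

theorem alphaMean_one_toReal (π : Θ → ℝ) (x : Θ → ℝ) (hx : ∀ θ, 0 < x θ) :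
    (alphaMean 1 π fun θ => ENNReal.ofReal (x θ)).toReal =
      Real.exp (∑ θ, π θ * Real.log (x θ)) := by
  have h1 : ∀ θ, (π θ : EReal) * AlphaInfo.h 1 (ENNReal.ofReal (x θ)) =
      ((π θ * Real.log (x θ) : ℝ) : EReal) := by
    intro θ
    rw [AlphaInfo.h, if_pos rfl, ENNReal.log_ofReal_of_pos (hx θ), EReal.coe_mul]
  rw [alphaMean, Finset.sum_congr rfl fun θ _ => h1 θ, ← coe_sum_ereal, hInv, if_pos rfl,
    EReal.exp_coe, ENNReal.toReal_ofReal (Real.exp_pos _).le]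

variable [Fintype A]

theorem meanAt_eq {α : ℝ} (h0 : idx α ≠ 0) {π : Θ → ℝ} (hπ : ∀ θ, 0 < π θ) {P : Θ → A → ℝ}
    (hP : IsChoiceRule P) {a : A} (ha : a ∈ carrier α P) :
    meanAt α π P a = (∑ θ, π θ * P θ a ^ idx α) ^ (1 / idx α) := by
  refine alphaMean_toReal h0 π (fun θ => (hπ θ).le) _ (fun θ => (hP θ).1 a) ?_
  rw [mem_carrier_iff] at ha
  rw [idx_pos_iff]
  split_ifs at ha with h
  · exact Or.inl h
  · exact Or.inr fun θ => lt_of_le_of_ne ((hP θ).1 a) (ha θ).symm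

theorem meanAt_one_eq {π : Θ → ℝ} {P : Θ → A → ℝ}
    (hP : IsChoiceRule P) {a : A} (ha : a ∈ carrier 1 P) :
    meanAt 1 π P a = Real.exp (∑ θ, π θ * Real.log (P θ a)) := by
  refine alphaMean_one_toReal π _ fun θ => ?_
  rw [mem_carrier_iff, if_neg (lt_irrefl 1)] at ha
  exact lt_of_le_of_ne ((hP θ).1 a) (ha θ).symm

theorem sum_rpow_pos {α : ℝ} [Nonempty Θ] {π : Θ → ℝ} (hπ : ∀ θ, 0 < π θ)
    {P : Θ → A → ℝ} (hP : IsChoiceRule P) {a : A} (ha : a ∈ carrier α P) :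
    0 < ∑ θ, π θ * P θ a ^ idx α := by
  have : ∃ θ, P θ a ≠ 0 := by
    rw [mem_carrier_iff] at ha
    split_ifs at ha
    · exact ha
    · exact ⟨Classical.arbitrary Θ, ha _⟩
  obtain ⟨θ, hθ⟩ := this
  refine Finset.sum_pos' (fun θ _ => mul_nonneg (hπ θ).le (Real.rpow_nonneg ((hP θ).1 a) _))
    ⟨θ, Finset.mem_univ θ, mul_pos (hπ θ) (Real.rpow_pos_of_pos ?_ _)⟩
  exact lt_of_le_of_ne ((hP θ).1 a) hθ.symm

theorem meanAt_pos {α : ℝ} [Nonempty Θ] {π : Θ → ℝ} (hπ : ∀ θ, 0 < π θ)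
    {P : Θ → A → ℝ} (hP : IsChoiceRule P) {a : A} (ha : a ∈ carrier α P) :
    0 < meanAt α π P a := by
  by_cases h0 : idx α = 0
  · obtain rfl := idx_eq_zero_iff.mp h0
    rw [meanAt_one_eq hP ha]; exact Real.exp_pos _
  · rw [meanAt_eq h0 hπ hP ha]
    exact Real.rpow_pos_of_pos (sum_rpow_pos hπ hP ha) _

theorem alphaZ_pos {α : ℝ} [Nonempty Θ] {π : Θ → ℝ} (hπ : ∀ θ, 0 < π θ)
    {P : Θ → A → ℝ} (hP : IsChoiceRule P) (h : HasAlphaIntegration α P) : 0 < alphaZ α π P := by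
  classical
  obtain ⟨a, ha⟩ := carrier_nonempty hP h
  unfold alphaZ
  refine Finset.sum_pos' (fun a _ => ?_) ⟨a, Finset.mem_univ a, ?_⟩
  · split_ifs with h'
    · exact (meanAt_pos hπ hP h').le
    · exact le_rfl
  · rw [if_pos ha]; exact meanAt_pos hπ hP ha

theorem alphaIntegration_pos_iff {α : ℝ} [Nonempty Θ] {π : Θ → ℝ} (hπ : ∀ θ, 0 < π θ)
    {P : Θ → A → ℝ} (hP : IsChoiceRule P) (h : HasAlphaIntegration α P) (a : A) :
    0 < alphaIntegration α π P a ↔ a ∈ carrier α P := by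
  unfold alphaIntegration
  split_ifs with ha
  · exact ⟨fun _ => ha, fun _ => div_pos (meanAt_pos hπ hP ha) (alphaZ_pos hπ hP h)⟩
  · exact ⟨fun h => absurd h (lt_irrefl _), fun h => absurd h ha⟩

theorem alphaIntegration_mem {α : ℝ} [Nonempty Θ] {π : Θ → ℝ} (hπ : ∀ θ, 0 < π θ)
    {P : Θ → A → ℝ} (hP : IsChoiceRule P) (h : HasAlphaIntegration α P) :
    alphaIntegration α π P ∈ stdSimplex ℝ A := by
  classical
  refine ⟨fun a => ?_, ?_⟩
  · by_cases ha : a ∈ carrier α P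
    · exact ((alphaIntegration_pos_iff hπ hP h a).mpr ha).le
    · rw [alphaIntegration, if_neg ha]
  · have : ∀ a, alphaIntegration α π P a =
        (if a ∈ carrier α P then meanAt α π P a else 0) / alphaZ α π P := fun a => by
      unfold alphaIntegration; split_ifs <;> simp
    rw [Finset.sum_congr rfl fun a _ => this a, ← Finset.sum_div]
    exact div_self (alphaZ_pos hπ hP h).ne'

/-- This is why the carrier is a union for `s > 0` and an intersection for `s ≤ 0`: the divergences
from the `P θ` to `m` are then finite. -/
theorem locFin_alphaIntegration {α : ℝ} [Nonempty Θ] {π : Θ → ℝ} (hπ : ∀ θ, 0 < π θ)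
    {P : Θ → A → ℝ} (hP : IsChoiceRule P) (h : HasAlphaIntegration α P) (θ : Θ) (a : A) :
    LocFin (idx α) (P θ a) (alphaIntegration α π P a) := by
  have h1 := alphaIntegration_pos_iff hπ hP h a
  rw [mem_carrier_iff] at h1
  constructor
  · intro hs h0
    rw [if_pos (idx_pos_iff.mp (by linarith)), h0] at h1
    by_contra hcon
    exact lt_irrefl _ (h1.mpr ⟨θ, hcon⟩)
  · intro hs h0
    rw [if_neg (fun hh => hs.not_gt (idx_pos_iff.mpr hh))] at h1
    by_contra hcon
    exact h1.mp (lt_of_le_of_ne ((alphaIntegration_mem hπ hP h).1 a) (Ne.symm hcon)) θ h0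

theorem locFin_alphaIntegration_left {α : ℝ} [Nonempty Θ] {π : Θ → ℝ} (hπ : ∀ θ, 0 < π θ)
    {P : Θ → A → ℝ} (hP : IsChoiceRule P) (h : HasAlphaIntegration α P) {a : A} {n : ℝ}
    (hn : ∀ θ, LocFin (idx α) (P θ a) n) : LocFin (idx α) (alphaIntegration α π P a) n := by
  have h1 := alphaIntegration_pos_iff hπ hP h a
  rw [mem_carrier_iff] at h1
  have hnn := (alphaIntegration_mem hπ hP h).1 a
  constructor
  · intro hs h0
    rw [if_pos (idx_pos_iff.mp (by linarith))] at h1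
    by_contra hcon
    obtain ⟨θ, hθ⟩ := h1.mp (lt_of_le_of_ne hnn (Ne.symm hcon))
    exact hθ ((hn θ).1 hs h0)
  · intro hs h0
    rw [if_neg (fun hh => hs.not_gt (idx_pos_iff.mpr hh)), h0] at h1
    by_contra hcon
    exact lt_irrefl _ (h1.mpr fun θ hθ => hcon ((hn θ).2 hs hθ))

theorem alphaIntegration_neg_one {π : Θ → ℝ} (hπ : π ∈ stdSimplex ℝ Θ) (hfull : ∀ θ, 0 < π θ)
    {P : Θ → A → ℝ} (hP : IsChoiceRule P) (a : A) :
    alphaIntegration (-1) π P a = ∑ θ, π θ * P θ a := by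
  classical
  have hs : idx (-1) = 1 := by norm_num [idx]
  have hmean : ∀ a, (if a ∈ carrier (-1) P then meanAt (-1) π P a else 0) = ∑ θ, π θ * P θ a := by
    intro a
    split_ifs with ha
    · rw [meanAt_eq (by rw [hs]; exact one_ne_zero) hfull hP ha, hs]; simp
    · rw [mem_carrier_iff, if_pos (by norm_num)] at ha
      push Not at ha
      simp [ha]
  have hZ : alphaZ (-1) π P = 1 := by
    rw [alphaZ, Finset.sum_congr rfl fun a _ => hmean a, Finset.sum_comm]
    simp_rw [← Finset.mul_sum]
    rw [Finset.sum_congr rfl fun θ _ => by rw [(hP θ).2, mul_one]]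
    exact hπ.2
  have := hmean a
  rw [alphaIntegration, hZ, div_one]
  exact this

/-- The average local divergence from a family to a point differs from a multiple of the local
divergence from its `α`-integration by an affine term. -/
theorem exists_pythagoras (α : ℝ) {π : Θ → ℝ} (hπ : π ∈ stdSimplex ℝ Θ) (hfull : ∀ θ, 0 < π θ)
    {P : Θ → A → ℝ} (hP : IsChoiceRule P) (h : HasAlphaIntegration α P) :
    ∃ k d : ℝ, ∃ c : A → ℝ, 0 ≤ k ∧ ∀ a n, 0 ≤ n → (∀ θ, LocFin (idx α) (P θ a) n) →
      ∑ θ, π θ * locDiv (idx α) (P θ a) n =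
        k * locDiv (idx α) (alphaIntegration α π P a) n + c a + d * n := by
  have hΘ := nonempty_of_mem_stdSimplex hπ
  set m := alphaIntegration α π P with hm
  have hmpos := alphaIntegration_pos_iff hfull hP h
  have hms := alphaIntegration_mem hfull hP h
  have hZ := alphaZ_pos hfull hP h
  rw [← hm] at hmpos hms
  have hmean : ∀ a ∈ carrier α P, m a * alphaZ α π P = meanAt α π P a := fun a ha => by
    rw [hm, alphaIntegration, if_pos ha, div_mul_cancel₀ _ hZ.ne']
  have hsum1 : ∀ n : ℝ, ∑ θ, π θ * n = n := fun n => by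
    rw [← Finset.sum_mul, hπ.2, one_mul]
  by_cases h1 : idx α = 1
  · have hα : α = -1 := by unfold idx at h1; linarith
    subst hα
    refine ⟨1, 0, fun a => ∑ θ, π θ * (P θ a * Real.log (P θ a)) - m a * Real.log (m a),
      zero_le_one, fun a n hn hf => ?_⟩
    have hma : m a = ∑ θ, π θ * P θ a := alphaIntegration_neg_one hπ hfull hP a
    have hlog : ∀ x : ℝ, (n = 0 → x = 0) → x * Real.log (x / n) = x * Real.log x - x * Real.log n :=
      fun x hx => by
        by_cases hx0 : x = 0
        · simp [hx0]
        · rw [Real.log_div hx0 fun hn => hx0 (hx hn)]; ring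
    have hmf := locFin_alphaIntegration_left hfull hP h hf
    rw [h1] at hf hmf ⊢
    simp only [locDiv, if_true]
    rw [hlog _ (hmf.1 le_rfl)]
    have : ∀ θ, π θ * (P θ a * Real.log (P θ a / n) - P θ a + n) =
        π θ * (P θ a * Real.log (P θ a)) - (π θ * P θ a) * Real.log n - π θ * P θ a + π θ * n :=
      fun θ => by rw [hlog _ ((hf θ).1 le_rfl)]; ring
    rw [Finset.sum_congr rfl fun θ _ => this θ, Finset.sum_add_distrib, Finset.sum_sub_distrib,
      Finset.sum_sub_distrib, ← Finset.sum_mul, ← hma, hsum1]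
    ring
  · by_cases h0 : idx α = 0
    · have hα := idx_eq_zero_iff.mp h0
      subst hα
      refine ⟨1, -Real.log (alphaZ 1 π P), fun a => ∑ θ, π θ * P θ a - m a, zero_le_one,
        fun a n hn hf => ?_⟩
      rw [h0] at hf ⊢
      simp only [locDiv, if_true, zero_ne_one, if_false]
      rcases hn.eq_or_lt with rfl | hn
      · simp
      · have hPa : ∀ θ, 0 < P θ a := fun θ =>
          lt_of_le_of_ne ((hP θ).1 a) fun h => hn.ne' ((hf θ).2 le_rfl h.symm)
        have hac : a ∈ carrier 1 P := by
          rw [mem_carrier_iff, if_neg (lt_irrefl 1)]; exact fun θ => (hPa θ).ne'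
        have hma := (hmpos a).mpr hac
        have h2 := hmean a hac
        rw [meanAt_one_eq hP hac] at h2
        have h3 := congrArg Real.log h2
        rw [Real.log_exp, Real.log_mul hma.ne' hZ.ne'] at h3
        have : ∀ θ, π θ * (n * Real.log (n / P θ a) - n + P θ a) =
            π θ * (n * Real.log n - n) - n * (π θ * Real.log (P θ a)) + π θ * P θ a :=
          fun θ => by rw [Real.log_div hn.ne' (hPa θ).ne']; ring
        rw [Finset.sum_congr rfl fun θ _ => this θ, Finset.sum_add_distrib,
          Finset.sum_sub_distrib, hsum1, ← Finset.mul_sum, ← h3, Real.log_div hn.ne' hma.ne']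
        ring
    · set s := idx α with hs
      set Z := alphaZ α π P
      have h3 : 1 - s ≠ 0 := sub_ne_zero.mpr (Ne.symm h1)
      -- By definition of the mean, `∑ θ, π θ * P θ a ^ s = (m a * Z) ^ s` on the carrier. So the
      -- mixed term is `Z ^ s` times that of `m`, and the other terms are affine in `n`.
      refine ⟨Z ^ s, 1 / s - Z ^ s / s,
        fun a => (∑ θ, π θ * P θ a) / (1 - s) - Z ^ s * m a / (1 - s),
        Real.rpow_nonneg hZ.le _, fun a n hn hf => ?_⟩
      have key : ∑ θ, π θ * (P θ a ^ s * n ^ (1 - s)) = Z ^ s * (m a ^ s * n ^ (1 - s)) := by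
        by_cases ha : a ∈ carrier α P
        · have h4 := hmean a ha
          rw [meanAt_eq h0 hfull hP ha] at h4
          have h5 : (m a * Z) ^ s = ∑ θ, π θ * P θ a ^ s := by
            rw [h4, ← Real.rpow_mul (sum_rpow_pos hfull hP ha).le, one_div_mul_cancel h0,
              Real.rpow_one]
          rw [Real.mul_rpow (hms.1 a) hZ.le] at h5
          simp_rw [← mul_assoc]
          rw [← Finset.sum_mul, ← h5]
          ring
        · have hma : m a = 0 := le_antisymm (not_lt.mp fun h => ha ((hmpos a).mp h)) (hms.1 a)
          rw [hma, Real.zero_rpow h0, zero_mul, mul_zero]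
          refine Finset.sum_eq_zero fun θ _ => ?_
          rw [mem_carrier_iff] at ha
          split_ifs at ha with hα
          · push Not at ha
            rw [ha θ, Real.zero_rpow h0]; ring
          · push Not at ha
            obtain ⟨θ', hθ'⟩ := ha
            -- A zero of some `P θ'` forces `n = 0` when `s ≤ 0`, and then `n ^ (1 - s)` vanishes.
            have hs0 : s ≤ 0 := not_lt.mp fun h => hα (idx_pos_iff.mp h)
            rw [(hf θ').2 hs0 hθ', Real.zero_rpow h3]; ring
      simp only [locDiv, if_neg h1, if_neg h0]
      have : ∀ θ, π θ * ((s * P θ a + (1 - s) * n - P θ a ^ s * n ^ (1 - s)) / (s * (1 - s))) =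
          (s * (π θ * P θ a) + π θ * ((1 - s) * n) - π θ * (P θ a ^ s * n ^ (1 - s))) /
            (s * (1 - s)) := fun θ => by ring
      rw [Finset.sum_congr rfl fun θ _ => this θ, ← Finset.sum_div, Finset.sum_sub_distrib,
        Finset.sum_add_distrib, hsum1, ← Finset.mul_sum, key]
      field_simp
      ring

/-- Summed over actions, the affine part does not depend on `n` in the simplex, and the divergence
from `m` to `n` is nonnegative and vanishes at `n = m`. -/
theorem sum_locDiv_alphaIntegration_le (α : ℝ) {π : Θ → ℝ} (hπ : π ∈ stdSimplex ℝ Θ)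
    (hfull : ∀ θ, 0 < π θ) {P : Θ → A → ℝ} (hP : IsChoiceRule P) (h : HasAlphaIntegration α P)
    {n : A → ℝ} (hn : n ∈ stdSimplex ℝ A) (hf : ∀ θ a, LocFin (idx α) (P θ a) (n a)) :
    ∑ θ, π θ * ∑ a, locDiv (idx α) (P θ a) (alphaIntegration α π P a) ≤
      ∑ θ, π θ * ∑ a, locDiv (idx α) (P θ a) (n a) := by
  have hΘ := nonempty_of_mem_stdSimplex hπ
  obtain ⟨k, d, c, hk, key⟩ := exists_pythagoras α hπ hfull hP h
  have hms := alphaIntegration_mem hfull hP h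
  have htot : ∀ n ∈ stdSimplex ℝ A, (∀ θ a, LocFin (idx α) (P θ a) (n a)) →
      ∑ θ, π θ * ∑ a, locDiv (idx α) (P θ a) (n a) =
        k * ∑ a, locDiv (idx α) (alphaIntegration α π P a) (n a) + ∑ a, c a + d := by
    intro n hn hf
    simp_rw [Finset.mul_sum]
    rw [Finset.sum_comm, Finset.sum_congr rfl fun a _ => key a (n a) (hn.1 a) fun θ => hf θ a,
      Finset.sum_add_distrib, Finset.sum_add_distrib, ← Finset.mul_sum, ← Finset.mul_sum, hn.2,
      mul_one]
  rw [htot _ hms (locFin_alphaIntegration hfull hP h), htot n hn hf,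
    Finset.sum_eq_zero fun a _ => locDiv_self (idx α) _ (hms.1 a), mul_zero]
  have : 0 ≤ ∑ a, locDiv (idx α) (alphaIntegration α π P a) (n a) :=
    Finset.sum_nonneg fun a _ => locDiv_nonneg (hms.1 a) (hn.1 a)
      (locFin_alphaIntegration_left hfull hP h fun θ => hf θ a)
  have := mul_nonneg hk this
  linarith

theorem sum_alphaDiv_eq_coe (α : ℝ) (π : Θ → ℝ) {P : Θ → A → ℝ} (hP : IsChoiceRule P) {n : A → ℝ}
    (hn : n ∈ stdSimplex ℝ A) (hf : ∀ θ a, LocFin (idx α) (P θ a) (n a)) :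
    ∑ θ, (π θ : EReal) * alphaDiv α (P θ) n =
      ((∑ θ, π θ * ∑ a, locDiv (idx α) (P θ a) (n a) : ℝ) : EReal) := by
  rw [coe_sum_ereal]
  refine Finset.sum_congr rfl fun θ _ => ?_
  rw [alphaDiv_eq_coe α (hP θ) hn (hf θ), EReal.coe_mul]

theorem sum_alphaDiv_eq_top (α : ℝ) {π : Θ → ℝ} (hfull : ∀ θ, 0 < π θ) {P : Θ → A → ℝ}
    (hP : IsChoiceRule P) {n : A → ℝ} (hn : n ∈ stdSimplex ℝ A)
    (hf : ¬ ∀ θ a, LocFin (idx α) (P θ a) (n a)) :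
    ∑ θ, (π θ : EReal) * alphaDiv α (P θ) n = ⊤ := by
  rw [not_forall] at hf
  obtain ⟨θ, hθ⟩ := hf
  refine sum_eq_top_ereal _ (fun θ => ?_) θ ?_
  · by_cases hf : ∀ a, LocFin (idx α) (P θ a) (n a)
    · rw [alphaDiv_eq_coe α (hP θ) hn hf, ← EReal.coe_mul]; exact EReal.coe_ne_bot _
    · rw [alphaDiv_eq_top α (hP θ) hn hf, EReal.coe_mul_top_of_pos (hfull θ)]; exact top_ne_bot
  · rw [alphaDiv_eq_top α (hP θ) hn hθ, EReal.coe_mul_top_of_pos (hfull θ)]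

theorem alphaInformation_eq (α : ℝ) {π : Θ → ℝ} (hπ : π ∈ stdSimplex ℝ Θ)
    (hfull : ∀ θ, 0 < π θ) {P : Θ → A → ℝ} (hP : IsChoiceRule P) (h : HasAlphaIntegration α P) :
    alphaInformation α π P = ((∑ θ, π θ * ∑ a, locDiv (idx α) (P θ a)
      (alphaIntegration α π P a) : ℝ) : EReal) := by
  have hΘ := nonempty_of_mem_stdSimplex hπ
  have hms := alphaIntegration_mem hfull hP h
  refine le_antisymm ?_ (le_iInf₂ fun n hn => ?_)
  · refine (iInf₂_le _ hms).trans_eq ?_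
    exact sum_alphaDiv_eq_coe α π hP hms (locFin_alphaIntegration hfull hP h)
  · by_cases hf : ∀ θ a, LocFin (idx α) (P θ a) (n a)
    · rw [sum_alphaDiv_eq_coe α π hP hn hf, EReal.coe_le_coe_iff]
      exact sum_locDiv_alphaIntegration_le α hπ hfull hP h hn hf
    · rw [sum_alphaDiv_eq_top α hfull hP hn hf]; exact le_top

/-- For `α ≥ 1`, a reference `n` at finite divergence from every `P θ` has its support inside every
support, so the intersection is nonempty. -/
theorem alphaInformation_eq_top {α : ℝ} {π : Θ → ℝ} (hfull : ∀ θ, 0 < π θ) {P : Θ → A → ℝ}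
    (hP : IsChoiceRule P) (h : ¬ HasAlphaIntegration α P) : alphaInformation α π P = ⊤ := by
  refine eq_top_iff.mpr (le_iInf₂ fun n hn => ?_)
  rw [sum_alphaDiv_eq_top α hfull hP hn]
  intro hf
  apply h
  by_cases hα : α < 1
  · exact Or.inl hα
  · refine Or.inr ⟨not_lt.mp hα, ?_⟩
    have : ∑ a, n a ≠ 0 := by rw [hn.2]; exact one_ne_zero
    obtain ⟨a, -, ha⟩ := Finset.exists_ne_zero_of_sum_ne_zero this
    refine ⟨a, Set.mem_iInter.mpr fun θ hθ => ha ((hf θ a).2 ?_ hθ)⟩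
    exact not_lt.mp fun h => hα (idx_pos_iff.mp h)

end Mean

/-! ### Action values as averaged conjugates. -/

section Main

variable {Θ A : Type*} [Fintype Θ]

/-- The average over states of the conjugate, at the action `a`. -/
def dualValue (s κ : ℝ) (π : Θ → ℝ) (u : A → Θ → ℝ) (lam : Θ → ℝ) (a : A) : ℝ :=
  ∑ θ, π θ * genConj s ((u a θ - lam θ) / κ)

/-- The bridge between condition 2 and duality: `h_α` of the exponential is an increasing affine
function of the conjugate for `s ≥ 0`, a decreasing one for `s < 0`. For `s < 0` an infinite
exponential is harmless, since `∞ ^ s = 0`. -/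
theorem h_expQ {α y : ℝ} (hy : expQ (2 - idx α) y ≠ ∞ ∨ idx α < 0) :
    h α (expQ (2 - idx α) y) =
      (((if idx α = 0 then 0 else 1) + (if idx α = 0 then 1 else idx α) * genConj (idx α) y : ℝ) :
        EReal) := by
  by_cases h0 : idx α = 0
  · have ht : expQ (2 - idx α) y ≠ ∞ := hy.resolve_right (by rw [h0]; exact lt_irrefl 0)
    have hz : expQ (2 - idx α) y ≠ 0 := fun hz => by have := (expQ_eq_zero hz).1; linarith
    rw [if_pos h0, if_pos h0, h, if_pos (idx_eq_zero_iff.mp h0), genConj, if_pos h0, expR,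
      ENNReal.log_pos_real hz ht, zero_add, one_mul]
  · have hα : α ≠ 1 := fun h => h0 (idx_eq_zero_iff.mpr h)
    rw [if_neg h0, if_neg h0, h, if_neg hα, genConj, if_neg h0, mul_div_cancel₀ _ h0,
      add_sub_cancel, expR, ENNReal.toReal_rpow]
    change ((expQ (2 - idx α) y ^ idx α : ℝ≥0∞) : EReal) = _
    have hne : expQ (2 - idx α) y ^ idx α ≠ ∞ := by
      rw [Ne, ENNReal.rpow_eq_top_iff, not_or]
      refine ⟨fun h => ?_, fun h => ?_⟩
      · have := (expQ_eq_zero h.1).1; linarith [h.2]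
      · rcases hy with hy | hy
        · exact hy h.1
        · linarith [h.2]
    rw [← EReal.toReal_coe_ennreal, EReal.coe_toReal (by simpa using hne) (by simp)]

theorem h_ne_bot_of_expQ {α y : ℝ} : h α (expQ (2 - idx α) y) ≠ ⊥ := by
  by_cases hy : expQ (2 - idx α) y ≠ ∞ ∨ idx α < 0
  · rw [h_expQ hy]; exact EReal.coe_ne_bot _
  · push Not at hy
    unfold h
    split_ifs
    · rw [hy.1, ENNReal.log_top]; exact top_ne_bot
    · simp

theorem actionValue_eq {α κ : ℝ} {π : Θ → ℝ} (hπ : π ∈ stdSimplex ℝ Θ) {u : A → Θ → ℝ}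
    {lam : Θ → ℝ} {a : A}
    (hy : ∀ θ, expQ (2 - idx α) ((u a θ - lam θ) / κ) ≠ ∞ ∨ idx α < 0) :
    actionValue α κ π u lam a = (((if idx α = 0 then 0 else 1) +
      (if idx α = 0 then 1 else idx α) * dualValue (idx α) κ π u lam a : ℝ) : EReal) := by
  rw [actionValue, qOf_eq, Finset.sum_congr rfl fun θ _ => by rw [h_expQ (hy θ), ← EReal.coe_mul],
    ← coe_sum_ereal]
  congr 1
  simp_rw [mul_add]
  rw [Finset.sum_add_distrib, ← Finset.sum_mul, hπ.2, one_mul, dualValue, Finset.mul_sum]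
  congr 1
  exact Finset.sum_congr rfl fun θ _ => by ring

theorem actionValue_eq_top {α κ : ℝ} {π : Θ → ℝ} (hfull : ∀ θ, 0 < π θ) {u : A → Θ → ℝ}
    {lam : Θ → ℝ} {a : A} {θ : Θ} (hs : 0 ≤ idx α)
    (hy : expQ (2 - idx α) ((u a θ - lam θ) / κ) = ∞) :
    actionValue α κ π u lam a = ⊤ := by
  rw [actionValue, qOf_eq]
  refine sum_eq_top_ereal _ (fun θ => ?_) θ ?_
  · rw [Ne, EReal.mul_eq_bot]
    have h1 := hfull θ
    have h2 : h α (expQ (2 - idx α) ((u a θ - lam θ) / κ)) ≠ ⊥ := h_ne_bot_of_expQ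
    simp [h2, not_lt.mpr h1.le]
  · have : h α (expQ (2 - idx α) ((u a θ - lam θ) / κ)) = ⊤ := by
      rw [hy, h]
      split_ifs with hα
      · simp
      · have : 0 < idx α := lt_of_le_of_ne hs fun h => hα (idx_eq_zero_iff.mp h.symm)
        rw [show (1 - α) / 2 = idx α from rfl, ENNReal.top_rpow_of_pos this]
        rfl
    rw [this, EReal.coe_mul_top_of_pos (hfull θ)]

variable [Fintype A]

/-! ### Optimality as joint maximality in the rule and the reference. -/

/-- The net payoff of a choice rule and a reference distribution, where the divergences are
finite. -/
def jointPayoff (s κ : ℝ) (π : Θ → ℝ) (u : A → Θ → ℝ) (Q : Θ → A → ℝ) (n : A → ℝ) : ℝ :=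
  ∑ θ, π θ * (∑ a, Q θ a * u a θ - κ * ∑ a, locDiv s (Q θ a) (n a))

theorem jointPayoff_eq (s κ : ℝ) (π : Θ → ℝ) (u : A → Θ → ℝ) (Q : Θ → A → ℝ) (n : A → ℝ) :
    jointPayoff s κ π u Q n =
      ∑ θ, π θ * ∑ a, Q θ a * u a θ - κ * ∑ θ, π θ * ∑ a, locDiv s (Q θ a) (n a) := by
  rw [jointPayoff, Finset.mul_sum, ← Finset.sum_sub_distrib]
  exact Finset.sum_congr rfl fun θ _ => by ring

theorem objective_eq (α κ : ℝ) {π : Θ → ℝ} (hπ : π ∈ stdSimplex ℝ Θ) (hfull : ∀ θ, 0 < π θ)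
    (u : A → Θ → ℝ) {P : Θ → A → ℝ} (hP : IsChoiceRule P) (h : HasAlphaIntegration α P) :
    objective α κ π u P =
      ((jointPayoff (idx α) κ π u P (alphaIntegration α π P) : ℝ) : EReal) := by
  rw [objective, alphaInformation_eq α hπ hfull hP h, ← EReal.coe_mul, ← EReal.coe_sub,
    jointPayoff_eq]

theorem objective_eq_bot {α κ : ℝ} (hκ : 0 < κ) {π : Θ → ℝ} (hfull : ∀ θ, 0 < π θ)
    (u : A → Θ → ℝ) {P : Θ → A → ℝ} (hP : IsChoiceRule P) (h : ¬ HasAlphaIntegration α P) :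
    objective α κ π u P = ⊥ := by
  rw [objective, alphaInformation_eq_top hfull hP h, EReal.coe_mul_top_of_pos hκ, EReal.sub_top]

theorem isOptimal_iff_jointPayoff {α κ : ℝ} (hκ : 0 < κ) {π : Θ → ℝ} (hπ : π ∈ stdSimplex ℝ Θ)
    (hfull : ∀ θ, 0 < π θ) (u : A → Θ → ℝ) {P : Θ → A → ℝ} (hP : IsChoiceRule P) :
    IsOptimal α κ π u P ↔ HasAlphaIntegration α P ∧
      ∀ Q n, IsChoiceRule Q → n ∈ stdSimplex ℝ A → (∀ θ a, LocFin (idx α) (Q θ a) (n a)) →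
        jointPayoff (idx α) κ π u Q n ≤
          jointPayoff (idx α) κ π u P (alphaIntegration α π P) := by
  have hΘ := nonempty_of_mem_stdSimplex hπ
  constructor
  · rintro ⟨-, h⟩
    have hhas : HasAlphaIntegration α P := by
      by_contra hcon
      have θ := Classical.arbitrary Θ
      -- A constant rule has equal supports at all states, hence a finite objective, so an optimal
      -- rule cannot have objective `-∞`.
      have hQ : IsChoiceRule fun _ : Θ => P θ := fun _ => hP θ
      have h1 : HasAlphaIntegration α fun _ : Θ => P θ := by
        by_cases hα : α < 1
        · exact Or.inl hα
        · refine Or.inr ⟨not_lt.mp hα, ?_⟩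
          have : ∑ a, P θ a ≠ 0 := by rw [(hP θ).2]; exact one_ne_zero
          obtain ⟨a, -, ha⟩ := Finset.exists_ne_zero_of_sum_ne_zero this
          exact ⟨a, Set.mem_iInter.mpr fun _ => ha⟩
      have h2 := h _ hQ
      rw [objective_eq_bot hκ hfull u hP hcon, objective_eq α κ hπ hfull u hQ h1, le_bot_iff] at h2
      exact EReal.coe_ne_bot _ h2
    refine ⟨hhas, fun Q n hQ hn hf => ?_⟩
    have hQhas : HasAlphaIntegration α Q := by
      by_contra hcon
      have h1 : alphaInformation α π Q ≤ _ := iInf₂_le n hn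
      rw [alphaInformation_eq_top hfull hQ hcon, sum_alphaDiv_eq_coe α π hQ hn hf, top_le_iff] at h1
      exact EReal.coe_ne_top _ h1
    have h2 := h Q hQ
    rw [objective_eq α κ hπ hfull u hP hhas, objective_eq α κ hπ hfull u hQ hQhas,
      EReal.coe_le_coe_iff] at h2
    refine le_trans ?_ h2
    rw [jointPayoff_eq, jointPayoff_eq]
    have := mul_le_mul_of_nonneg_left
      (sum_locDiv_alphaIntegration_le α hπ hfull hQ hQhas hn hf) hκ.le
    linarith
  · rintro ⟨hhas, h⟩
    refine ⟨hP, fun Q hQ => ?_⟩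
    by_cases hQhas : HasAlphaIntegration α Q
    · rw [objective_eq α κ hπ hfull u hP hhas, objective_eq α κ hπ hfull u hQ hQhas,
        EReal.coe_le_coe_iff]
      exact h Q _ hQ (alphaIntegration_mem hfull hQ hQhas)
        (locFin_alphaIntegration hfull hQ hQhas)
    · rw [objective_eq_bot hκ hfull u hQ hQhas]; exact bot_le

/-- Comparison of actions by dual values, equivalent to the comparison of action values. -/
def DualCondition (s κ : ℝ) (π : Θ → ℝ) (u : A → Θ → ℝ) (lam : Θ → ℝ) (m : A → ℝ) : Prop :=
  (0 ≤ s → ∀ b θ, expQ (2 - s) ((u b θ - lam θ) / κ) ≠ ∞) ∧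
    ∀ a b, 0 < m a → dualValue s κ π u lam b ≤ dualValue s κ π u lam a

/-- The coefficient of the dual value has the sign of `s` for `s ≠ 0` and is `1` at `s = 0`, which
exchanges maximum and minimum for `α > 1`. -/
theorem actionValue_condition_iff {α κ : ℝ} {π : Θ → ℝ} (hπ : π ∈ stdSimplex ℝ Θ)
    (hfull : ∀ θ, 0 < π θ) {u : A → Θ → ℝ} {lam : Θ → ℝ} {m : A → ℝ} (hm : m ∈ stdSimplex ℝ A)
    (hfin : ∀ a, 0 < m a → ∀ θ, expQ (2 - idx α) ((u a θ - lam θ) / κ) ≠ ∞) :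
    ((α ≤ 1 → ∀ a ∈ Function.support m,
        actionValue α κ π u lam a = ⨆ b, actionValue α κ π u lam b) ∧
      (1 < α → ∀ a ∈ Function.support m,
        actionValue α κ π u lam a = ⨅ b, actionValue α κ π u lam b)) ↔
    DualCondition (idx α) κ π u lam m := by
  have hsupp : ∀ a, a ∈ Function.support m ↔ 0 < m a := fun a =>
    ⟨fun h => lt_of_le_of_ne (hm.1 a) (Ne.symm h), fun h => h.ne'⟩
  simp only [hsupp]
  by_cases hα : α ≤ 1
  · have hs : 0 ≤ idx α := by unfold idx; linarith
    have hcoef : 0 < (if idx α = 0 then 1 else idx α) := by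
      split_ifs with h
      · exact one_pos
      · exact lt_of_le_of_ne hs (Ne.symm h)
    rw [DualCondition]
    simp only [hα, not_lt.mpr hα, forall_true_left, false_imp_iff, and_true, hs]
    constructor
    · intro h
      have hle : ∀ a, 0 < m a → ∀ b, actionValue α κ π u lam b ≤ actionValue α κ π u lam a :=
        fun a ha b => by rw [h a ha]; exact le_iSup _ b
      have : ∑ a, m a ≠ 0 := by rw [hm.2]; exact one_ne_zero
      obtain ⟨a₀, -, ha₀⟩ := Finset.exists_ne_zero_of_sum_ne_zero this
      have ha₀ := (hsupp a₀).mp ha₀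
      -- An infinite exponential anywhere would give an action value `⊤`, exceeding the finite value
      -- at a support action `a₀`.
      have hall : ∀ b θ, expQ (2 - idx α) ((u b θ - lam θ) / κ) ≠ ∞ := by
        intro b θ hb
        have := hle a₀ ha₀ b
        rw [actionValue_eq_top hfull hs hb, actionValue_eq hπ fun θ => Or.inl (hfin a₀ ha₀ θ),
          top_le_iff] at this
        exact EReal.coe_ne_top _ this
      refine ⟨hall, fun a b ha => ?_⟩
      have := hle a ha b
      rw [actionValue_eq hπ fun θ => Or.inl (hall a θ), actionValue_eq hπ fun θ => Or.inl (hall b θ),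
        EReal.coe_le_coe_iff, add_le_add_iff_left] at this
      exact le_of_mul_le_mul_left this hcoef
    · rintro ⟨hall, h⟩ a ha
      refine le_antisymm (le_iSup _ a) (iSup_le fun b => ?_)
      rw [actionValue_eq hπ fun θ => Or.inl (hall a θ), actionValue_eq hπ fun θ => Or.inl (hall b θ),
        EReal.coe_le_coe_iff, add_le_add_iff_left]
      exact mul_le_mul_of_nonneg_left (h a b ha) hcoef.le
  · have hs : idx α < 0 := by unfold idx; linarith
    rw [DualCondition]
    simp only [hα, not_le.mp hα, forall_true_left, false_imp_iff, true_and, hs.not_ge]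
    have hv := fun a => actionValue_eq (κ := κ) (u := u) (lam := lam) (a := a) hπ
      fun θ => Or.inr hs
    simp only [hs.ne, if_false] at hv
    constructor
    · intro h a b ha
      have : actionValue α κ π u lam a ≤ actionValue α κ π u lam b := by
        rw [h a ha]; exact iInf_le _ b
      rw [hv, hv, EReal.coe_le_coe_iff, add_le_add_iff_left] at this
      nlinarith
    · intro h a ha
      refine le_antisymm (le_iInf fun b => ?_) (iInf_le _ a)
      rw [hv, hv, EReal.coe_le_coe_iff, add_le_add_iff_left]
      exact mul_le_mul_of_nonpos_left (h a b ha) hs.le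

/-! ### Sufficiency of the two conditions. -/

theorem sum_genConj_eq (s κ : ℝ) (π : Θ → ℝ) (u : A → Θ → ℝ) (lam : Θ → ℝ) (n : A → ℝ) :
    ∑ θ, π θ * (lam θ + κ * ∑ a, n a * genConj s ((u a θ - lam θ) / κ)) =
      ∑ θ, π θ * lam θ + κ * ∑ a, n a * dualValue s κ π u lam a := by
  simp_rw [mul_add, Finset.sum_add_distrib, dualValue, Finset.mul_sum]
  congr 1
  rw [Finset.sum_comm]
  exact Finset.sum_congr rfl fun a _ => Finset.sum_congr rfl fun θ _ => by ring

/-- Weak duality with the multipliers of `m` bounds the payoff of every pair `(Q, n)` by a function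
affine in `n`. The dual condition makes `m` a maximizer of it, and the bound is tight at `(P, m)`.
-/
theorem jointPayoff_le_of_dualCondition {α κ : ℝ} (hκ : 0 < κ) {π : Θ → ℝ}
    (hfull : ∀ θ, 0 < π θ) {u : A → Θ → ℝ} {P : Θ → A → ℝ}
    (hP : IsChoiceRule P) {m : A → ℝ} (hm : m ∈ stdSimplex ℝ A) {lam : Θ → ℝ}
    (hlam : ∀ θ, lam θ = stateConstant α κ (fun a => u a θ) m)
    (hq : ∀ θ, IsQExponential α κ (fun a => u a θ) m (P θ))
    (hd : DualCondition (idx α) κ π u lam m) {Q : Θ → A → ℝ} {n : A → ℝ} (hQ : IsChoiceRule Q)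
    (hn : n ∈ stdSimplex ℝ A) (hf : ∀ θ a, LocFin (idx α) (Q θ a) (n a)) :
    jointPayoff (idx α) κ π u Q n ≤ jointPayoff (idx α) κ π u P m := by
  have : ∑ a, m a ≠ 0 := by rw [hm.2]; exact one_ne_zero
  obtain ⟨a₀, -, ha₀⟩ := Finset.exists_ne_zero_of_sum_ne_zero this
  have ha₀ := lt_of_le_of_ne (hm.1 a₀) (Ne.symm ha₀)
  have h1 : jointPayoff (idx α) κ π u P m =
      ∑ θ, π θ * lam θ + κ * ∑ a, m a * dualValue (idx α) κ π u lam a := by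
    rw [← sum_genConj_eq, jointPayoff]
    refine Finset.sum_congr rfl fun θ _ => ?_
    congr 1
    refine net_payoff_eq hκ (fun a => u a θ) (lam θ) (hP θ) fun a => ?_
    rw [hlam θ]
    exact (qExponential_fenchel_eq hκ _ hm (hP θ) (hq θ) a).2
  have h2 : jointPayoff (idx α) κ π u Q n ≤
      ∑ θ, π θ * lam θ + κ * ∑ a, n a * dualValue (idx α) κ π u lam a := by
    rw [← sum_genConj_eq, jointPayoff]
    refine Finset.sum_le_sum fun θ _ => mul_le_mul_of_nonneg_left ?_ (hfull θ).le
    refine net_payoff_le hκ (fun a => u a θ) (lam θ) (hQ θ) hn (hf θ) (fun h a => ?_) fun a => ?_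
    · rw [hlam θ]
      exact bracket_nonneg hκ (fun a => u a θ) hm h a
    · rcases lt_or_ge (idx α) 0 with h | h
      · exact Or.inr (Or.inr h)
      · exact Or.inr (Or.inl (hd.1 h a θ))
  have h3 : ∑ a, m a * dualValue (idx α) κ π u lam a = dualValue (idx α) κ π u lam a₀ := by
    have : ∀ a, m a * dualValue (idx α) κ π u lam a = m a * dualValue (idx α) κ π u lam a₀ := by
      intro a
      rcases (hm.1 a).eq_or_lt with h | h
      · rw [← h]; simp
      · rw [le_antisymm (hd.2 a₀ a ha₀) (hd.2 a a₀ h)]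
    rw [Finset.sum_congr rfl fun a _ => this a, ← Finset.sum_mul, hm.2, one_mul]
  have h4 : ∑ a, n a * dualValue (idx α) κ π u lam a ≤ dualValue (idx α) κ π u lam a₀ := by
    calc ∑ a, n a * dualValue (idx α) κ π u lam a
        ≤ ∑ a, n a * dualValue (idx α) κ π u lam a₀ := Finset.sum_le_sum fun a _ =>
          mul_le_mul_of_nonneg_left (hd.2 a₀ a ha₀) (hn.1 a)
      _ = _ := by rw [← Finset.sum_mul, hn.2, one_mul]
  rw [h1, h3]
  have := mul_le_mul_of_nonneg_left h4 hκ.le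
  linarith

/-! ### Necessity of the two conditions. -/

/-- With the reference fixed the joint payoff separates over states, so it suffices to change `P` at
one state. -/
theorem isStateSolution_of_jointPayoff_le {α κ : ℝ} (hκ : 0 < κ) {π : Θ → ℝ}
    (hfull : ∀ θ, 0 < π θ) {u : A → Θ → ℝ} {P : Θ → A → ℝ} (hP : IsChoiceRule P) {m : A → ℝ}
    (hm : m ∈ stdSimplex ℝ A) (hf : ∀ θ a, LocFin (idx α) (P θ a) (m a))
    (hle : ∀ Q, IsChoiceRule Q → (∀ θ a, LocFin (idx α) (Q θ a) (m a)) →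
        jointPayoff (idx α) κ π u Q m ≤ jointPayoff (idx α) κ π u P m) (θ : Θ) :
    IsStateSolution α κ (fun a => u a θ) m (P θ) := by
  classical
  refine ⟨hP θ, fun p hp => ?_⟩
  by_cases hpf : ∀ a, LocFin (idx α) (p a) (m a)
  · rw [stateObjective_eq_coe α κ _ hp hm hpf, stateObjective_eq_coe α κ _ (hP θ) hm (hf θ),
      EReal.coe_le_coe_iff]
    have h1 := hle (Function.update P θ p)
      (fun θ' => by
        by_cases h : θ' = θ
        · subst h; simpa using hp
        · simpa [h] using hP θ')
      (fun θ' a => by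
        by_cases h : θ' = θ
        · subst h; simpa using hpf a
        · simpa [h] using hf θ' a)
    have herase : ∑ x ∈ Finset.univ.erase θ, π x * (∑ a, Function.update P θ p x a * u a x -
          κ * ∑ a, locDiv (idx α) (Function.update P θ p x a) (m a)) =
        ∑ x ∈ Finset.univ.erase θ, π x * (∑ a, P x a * u a x -
          κ * ∑ a, locDiv (idx α) (P x a) (m a)) :=
      Finset.sum_congr rfl fun x hx => by
        rw [Function.update_of_ne (Finset.ne_of_mem_erase hx)]
    unfold jointPayoff at h1
    rw [← Finset.add_sum_erase _ _ (Finset.mem_univ θ),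
      ← Finset.add_sum_erase _ (fun θ => π θ * (∑ a, P θ a * u a θ -
        κ * ∑ a, locDiv (idx α) (P θ a) (m a))) (Finset.mem_univ θ),
      herase, add_le_add_iff_right, Function.update_self] at h1
    exact le_of_mul_le_mul_left h1 (hfull θ)
  · rw [stateObjective_eq_bot α hκ _ hp hm hpf]; exact bot_le

theorem LocFin.smul {s p q c d : ℝ} (hf : LocFin s p q) (hc : 0 < c) (hd : 0 < d) :
    LocFin s (c * p) (d * q) := by
  refine ⟨fun h h' => ?_, fun h h' => ?_⟩
  · rw [hf.1 h ((mul_eq_zero.mp h').resolve_left hd.ne'), mul_zero]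
  · rw [hf.2 h ((mul_eq_zero.mp h').resolve_left hc.ne'), mul_zero]

theorem deriv_nonpos_of_eventually_le {ψ : ℝ → ℝ} {D : ℝ} (hψ : HasDerivAt ψ D 0)
    (hle : ∀ᶠ ε in 𝓝[>] (0 : ℝ), ψ ε ≤ ψ 0) : D ≤ 0 := by
  have h := (hasDerivAt_iff_tendsto_slope_zero.mp hψ).mono_left
    (nhdsWithin_mono (0 : ℝ) (s := Set.Ioi 0) fun x hx => ne_of_gt hx)
  refine le_of_tendsto h ?_
  filter_upwards [hle, self_mem_nhdsWithin] with ε h1 h2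
  rw [zero_add, smul_eq_mul]
  exact mul_nonpos_of_nonneg_of_nonpos (inv_nonneg.mpr (le_of_lt h2)) (by linarith)

/-- First-order condition for shifting mass to the action `b`, with likelihood ratios `τ`. -/
theorem first_order_condition {α κ : ℝ} (hκ : 0 < κ) {π : Θ → ℝ}
    (hfull : ∀ θ, 0 < π θ) {u : A → Θ → ℝ} {P : Θ → A → ℝ}
    (hP : IsChoiceRule P) {m : A → ℝ} (hm : m ∈ stdSimplex ℝ A) {lam : Θ → ℝ}
    (hlam : ∀ θ, lam θ = stateConstant α κ (fun a => u a θ) m)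
    (hq : ∀ θ, IsQExponential α κ (fun a => u a θ) m (P θ))
    (hle : ∀ Q n, IsChoiceRule Q → n ∈ stdSimplex ℝ A → (∀ θ a, LocFin (idx α) (Q θ a) (n a)) →
        jointPayoff (idx α) κ π u Q n ≤ jointPayoff (idx α) κ π u P m)
    (b : A) (τ : Θ → ℝ) (hτ : ∀ θ, 0 < τ θ) :
    ∑ θ, π θ * (τ θ * ((u b θ - lam θ) / κ) - locDiv (idx α) (τ θ) 1) ≤
      ∑ a, m a * dualValue (idx α) κ π u lam a := by
  classical
  set s := idx α with hs
  have hfe := fun θ a => qExponential_fenchel_eq hκ (fun a => u a θ) hm (hP θ) (hq θ) a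
  have hexp := fun θ => (isQExponential_iff hκ (fun a => u a θ) hm (hP θ)).mp (hq θ)
  simp only [← hlam] at hfe hexp
  -- A lower bound for the payoff along the perturbation, exact at `ε = 0`. The mass moved to `b` is
  -- charged separately, which keeps `ψ` differentiable even if `m b = 0`.
  set ψ : ℝ → ℝ := fun ε => ∑ θ, π θ * (((1 - ε * τ θ) * ∑ a, P θ a * u a θ + ε * (τ θ * u b θ)) -
    κ * (∑ a, locDiv s ((1 - ε * τ θ) * P θ a) ((1 - ε) * m a) + ε * locDiv s (τ θ) 1)) with hψ
  set D : ℝ := ∑ θ, π θ * ((-τ θ * ∑ a, P θ a * u a θ + τ θ * u b θ) -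
    κ * (∑ a, ((1 - τ θ) * (m a * genConj s ((u a θ - lam θ) / κ)) - τ θ * locDiv s (P θ a) (m a)) +
      locDiv s (τ θ) 1)) with hD
  have hder : HasDerivAt ψ D 0 := by
    refine HasDerivAt.fun_sum fun θ _ => HasDerivAt.const_mul (π θ) ?_
    refine HasDerivAt.sub (HasDerivAt.add ?_ ?_) (HasDerivAt.const_mul κ (HasDerivAt.add ?_ ?_))
    · simpa using (((hasDerivAt_id (0 : ℝ)).mul_const (τ θ)).const_sub 1).mul_const
        (∑ a, P θ a * u a θ)
    · simpa using (hasDerivAt_id (0 : ℝ)).mul_const (τ θ * u b θ)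
    · refine HasDerivAt.fun_sum fun a _ => ?_
      refine hasDerivAt_locDiv (τ θ) (hm.1 a) (hfe θ a).1 fun ha => ⟨?_, (hexp θ).1 a ha⟩
      rw [hlam θ]
      exact expQ_ne_top_of_support hκ (fun a => u a θ) hm (lamBar_le_stateConstant α κ _ m) ha
    · simpa using (hasDerivAt_id (0 : ℝ)).mul_const (locDiv s (τ θ) 1)
  have hψ0 : ψ 0 = jointPayoff s κ π u P m := by
    simp [hψ, jointPayoff]
  have hev : ∀ᶠ ε in 𝓝[>] (0 : ℝ), ψ ε ≤ ψ 0 := by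
    have hc : ∀ c : ℝ, ∀ᶠ ε in 𝓝[>] (0 : ℝ), 0 < 1 - ε * c := fun c => by
      have : ContinuousAt (fun ε : ℝ => 1 - ε * c) 0 := by fun_prop
      exact (this.eventually (lt_mem_nhds (by simp))).filter_mono nhdsWithin_le_nhds
    filter_upwards [eventually_all.mpr fun θ => hc (τ θ), hc 1, self_mem_nhdsWithin] with ε h1 h2 h3
    rw [mul_one] at h2
    have h3 : 0 < ε := h3
    rw [hψ0]
    set Q : Θ → A → ℝ := fun θ a => (1 - ε * τ θ) * P θ a + if a = b then ε * τ θ else 0 with hQ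
    set n : A → ℝ := fun a => (1 - ε) * m a + if a = b then ε else 0 with hn
    have hQs : IsChoiceRule Q := fun θ => by
      refine ⟨fun a => add_nonneg (mul_nonneg (h1 θ).le ((hP θ).1 a)) ?_, ?_⟩
      · split_ifs
        · exact (mul_pos h3 (hτ θ)).le
        · exact le_rfl
      · simp only [hQ]
        rw [Finset.sum_add_distrib, ← Finset.mul_sum, (hP θ).2, Finset.sum_ite_eq' Finset.univ b]
        simp
    have hns : n ∈ stdSimplex ℝ A := by
      refine ⟨fun a => add_nonneg (mul_nonneg h2.le (hm.1 a)) ?_, ?_⟩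
      · split_ifs
        · exact h3.le
        · exact le_rfl
      · simp only [hn]
        rw [Finset.sum_add_distrib, ← Finset.mul_sum, hm.2, Finset.sum_ite_eq' Finset.univ b]
        simp
    -- At `b` this is subadditivity of the perspective together with its homogeneity.
    have hloc : ∀ θ a, LocFin s (Q θ a) (n a) ∧ locDiv s (Q θ a) (n a) ≤
        locDiv s ((1 - ε * τ θ) * P θ a) ((1 - ε) * m a) +
          if a = b then ε * locDiv s (τ θ) 1 else 0 := by
      intro θ a
      have hf := (hfe θ a).1.smul (h1 θ) h2
      by_cases hab : a = b
      · simp only [hQ, hn, if_pos hab]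
        have h4 : locDiv s (ε * τ θ) ε = ε * locDiv s (τ θ) 1 := by
          have := locDiv_mul (s := s) (hτ θ).le zero_le_one h3
          rwa [mul_one] at this
        rw [← h4]
        exact locDiv_add_le (mul_nonneg (h1 θ).le ((hP θ).1 a)) (mul_nonneg h2.le (hm.1 a)) hf
          (mul_pos h3 (hτ θ)) h3
      · simp only [hQ, hn, if_neg hab, add_zero]
        exact ⟨hf, le_rfl⟩
    refine le_trans ?_ (hle Q n hQs hns fun θ a => (hloc θ a).1)
    refine Finset.sum_le_sum fun θ _ => mul_le_mul_of_nonneg_left ?_ (hfull θ).le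
    have h5 : ∑ a, Q θ a * u a θ = (1 - ε * τ θ) * ∑ a, P θ a * u a θ + ε * (τ θ * u b θ) := by
      simp only [hQ, add_mul, ite_mul, zero_mul]
      rw [Finset.sum_add_distrib, Finset.sum_ite_eq' Finset.univ b, Finset.mul_sum]
      simp only [Finset.mem_univ, if_true, mul_assoc]
    have h6 : ∑ a, locDiv s (Q θ a) (n a) ≤
        ∑ a, locDiv s ((1 - ε * τ θ) * P θ a) ((1 - ε) * m a) + ε * locDiv s (τ θ) 1 := by
      refine (Finset.sum_le_sum fun a _ => (hloc θ a).2).trans_eq ?_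
      rw [Finset.sum_add_distrib, Finset.sum_ite_eq' Finset.univ b]
      simp
    rw [h5]
    have := mul_le_mul_of_nonneg_left h6 hκ.le
    linarith
  have hD0 := deriv_nonpos_of_eventually_le hder hev
  have hDeq : D = κ * (∑ θ, π θ * (τ θ * ((u b θ - lam θ) / κ) - locDiv s (τ θ) 1) -
      ∑ a, m a * dualValue s κ π u lam a) := by
    have h7 := sum_genConj_eq s κ π u lam m
    simp_rw [mul_add] at h7
    rw [Finset.sum_add_distrib, add_right_inj] at h7
    rw [mul_sub, ← h7, hD, Finset.mul_sum, ← Finset.sum_sub_distrib]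
    refine Finset.sum_congr rfl fun θ _ => ?_
    have h8 := net_payoff_eq hκ (fun a => u a θ) (lam θ) (hP θ) fun a => (hfe θ a).2
    rw [Finset.sum_sub_distrib, ← Finset.mul_sum, ← Finset.mul_sum]
    have h9 : κ * (π θ * (τ θ * ((u b θ - lam θ) / κ) - locDiv s (τ θ) 1)) =
        π θ * (τ θ * (u b θ - lam θ) - κ * locDiv s (τ θ) 1) := by
      field_simp
    rw [h9]
    linear_combination (-π θ * τ θ) * h8
  rw [hDeq] at hD0
  by_contra hcon
  exact absurd hD0 (not_le.mpr (mul_pos hκ (sub_pos.mpr (not_le.mp hcon))))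

theorem dualCondition_of_jointPayoff_le {α κ : ℝ} (hκ : 0 < κ) {π : Θ → ℝ}
    (hπ : π ∈ stdSimplex ℝ Θ) (hfull : ∀ θ, 0 < π θ) {u : A → Θ → ℝ} {P : Θ → A → ℝ}
    (hP : IsChoiceRule P) {m : A → ℝ} (hm : m ∈ stdSimplex ℝ A) {lam : Θ → ℝ}
    (hlam : ∀ θ, lam θ = stateConstant α κ (fun a => u a θ) m)
    (hq : ∀ θ, IsQExponential α κ (fun a => u a θ) m (P θ))
    (hle : ∀ Q n, IsChoiceRule Q → n ∈ stdSimplex ℝ A → (∀ θ a, LocFin (idx α) (Q θ a) (n a)) →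
        jointPayoff (idx α) κ π u Q n ≤ jointPayoff (idx α) κ π u P m) :
    DualCondition (idx α) κ π u lam m := by
  classical
  have hfoc := first_order_condition hκ hfull hP hm hlam hq hle
  have hΘ := nonempty_of_mem_stdSimplex hπ
  set s := idx α with hs
  -- `C` is the `m`-average of the dual values. Once every dual value is shown to be at most `C`,
  -- those with positive weight must equal it.
  set C := ∑ a, m a * dualValue s κ π u lam a with hC
  have hlt : ∀ b, ∀ c : Θ → ℝ, (∀ θ, (0 ≤ s ∧ expQ (2 - s) ((u b θ - lam θ) / κ) = ∞) ∨
      c θ < genConj s ((u b θ - lam θ) / κ)) → ∑ θ, π θ * c θ < C := by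
    intro b c hc
    choose τ hτ1 hτ2 using fun θ => exists_lt_linear_sub_locDiv (hc θ)
    refine lt_of_lt_of_le ?_ (hfoc b τ hτ1)
    exact Finset.sum_lt_sum_of_nonempty Finset.univ_nonempty fun θ _ =>
      mul_lt_mul_of_pos_left (hτ2 θ) (hfull θ)
  have hub : ∀ b, dualValue s κ π u lam b ≤ C := by
    intro b
    refine le_of_forall_pos_le_add fun ε hε => ?_
    have h1 := hlt b (fun θ => genConj s ((u b θ - lam θ) / κ) - ε) fun θ => Or.inr (by linarith)
    simp_rw [mul_sub] at h1
    rw [Finset.sum_sub_distrib, ← Finset.sum_mul, hπ.2, one_mul] at h1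
    unfold dualValue
    linarith
  constructor
  · intro hs0 b θ₀ htop
    set K := ∑ θ, π θ * (genConj s ((u b θ - lam θ) / κ) - 1) with hK
    -- At `θ₀` the supremum is infinite, so the lower bound there is free; it is chosen to make the
    -- total equal to `C`, which gives `C < C`.
    have h1 := hlt b (fun θ => (genConj s ((u b θ - lam θ) / κ) - 1) +
      if θ = θ₀ then (C - K) / π θ₀ else 0) fun θ => by
        by_cases h : θ = θ₀
        · left; rw [h]; exact ⟨hs0, htop⟩
        · right; simp [h]
    simp_rw [mul_add, mul_ite, mul_zero] at h1
    rw [Finset.sum_add_distrib, ← hK, Finset.sum_ite_eq' Finset.univ θ₀,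
      if_pos (Finset.mem_univ _), mul_div_cancel₀ _ (hfull θ₀).ne'] at h1
    linarith
  · intro a b ha
    refine (hub b).trans ?_
    by_contra hcon
    have h1 : C < ∑ a, m a * C := by
      refine Finset.sum_lt_sum (fun a _ => mul_le_mul_of_nonneg_left (hub a) (hm.1 a))
        ⟨a, Finset.mem_univ a, mul_lt_mul_of_pos_left (not_le.mp hcon) ha⟩
    rw [← Finset.sum_mul, hm.2, one_mul] at h1
    exact lt_irrefl _ h1

theorem isOptimal_iff_dualCondition {α κ : ℝ} (hκ : 0 < κ) {π : Θ → ℝ}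
    (hπ : π ∈ stdSimplex ℝ Θ) (hfull : ∀ θ, 0 < π θ) {u : A → Θ → ℝ} {P : Θ → A → ℝ}
    (hP : IsChoiceRule P) {lam : Θ → ℝ}
    (hlam : ∀ θ, lam θ = stateConstant α κ (fun a => u a θ) (alphaIntegration α π P)) :
    IsOptimal α κ π u P ↔ HasAlphaIntegration α P ∧
      (∀ θ, IsQExponential α κ (fun a => u a θ) (alphaIntegration α π P) (P θ)) ∧
      DualCondition (idx α) κ π u lam (alphaIntegration α π P) := by
  have hΘ := nonempty_of_mem_stdSimplex hπ
  rw [isOptimal_iff_jointPayoff hκ hπ hfull u hP]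
  refine and_congr_right fun h => ?_
  have hm := alphaIntegration_mem hfull hP h
  constructor
  · intro hle
    have hq : ∀ θ, IsQExponential α κ (fun a => u a θ) (alphaIntegration α π P) (P θ) := fun θ =>
      (isStateSolution_iff α hκ _ hm (hP θ)).mp (isStateSolution_of_jointPayoff_le hκ hfull hP hm
        (locFin_alphaIntegration hfull hP h) (fun Q hQ hf => hle Q _ hQ hm hf) θ)
    exact ⟨hq, dualCondition_of_jointPayoff_le hκ hπ hfull hP hm hlam hq hle⟩
  · rintro ⟨hq, hd⟩ Q n hQ hn hf
    exact jointPayoff_le_of_dualCondition hκ hfull hP hm hlam hq hd hQ hn hf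

/-! ### The Shannon case `α = -1`. -/

theorem expR_one (y : ℝ) : expR 1 y = Real.exp y := by
  rw [expR, expQ, if_pos (by norm_num), ENNReal.toReal_ofReal (Real.exp_pos y).le]

theorem expQ_one_ne_top (y : ℝ) : expQ (2 - 1) y ≠ ∞ := by
  rw [Ne, expQ_eq_top]; exact fun h => lt_irrefl _ h.1

/-- At `α = -1` the optimality condition takes the multinomial logit form. -/
theorem isOptimal_neg_one_iff {κ : ℝ} (hκ : 0 < κ) {π : Θ → ℝ}
    (hπ : π ∈ stdSimplex ℝ Θ) (hfull : ∀ θ, 0 < π θ) {u : A → Θ → ℝ} {P : Θ → A → ℝ}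
    (hP : IsChoiceRule P) {r : A → ℝ} (hr : ∀ a, r a = ∑ θ, π θ * P θ a) :
    IsOptimal (-1) κ π u P ↔
      (∀ θ a, P θ a = r a * Real.exp (u a θ / κ) / ∑ b, r b * Real.exp (u b θ / κ)) ∧
      ∀ a, ∑ θ, π θ * (Real.exp (u a θ / κ) / ∑ b, r b * Real.exp (u b θ / κ)) ≤ 1 := by
  have hΘ := nonempty_of_mem_stdSimplex hπ
  have hhas : HasAlphaIntegration (-1) P := Or.inl (by norm_num)
  have hmr : alphaIntegration (-1) π P = r := funext fun a => by
    rw [alphaIntegration_neg_one hπ hfull hP, hr]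
  have hm := alphaIntegration_mem hfull hP hhas
  rw [isOptimal_iff_dualCondition hκ hπ hfull hP fun θ => rfl]
  rw [hmr] at hm ⊢
  have hs : idx (-1) = 1 := by norm_num [idx]
  have hI : ∀ v : A → ℝ, Inner (-1) κ v r := fun v => Or.inl (Or.inl le_rfl)
  set lam : Θ → ℝ := fun θ => stateConstant (-1) κ (fun a => u a θ) r with hlam
  have hsplit : ∀ a θ, Real.exp ((u a θ - lam θ) / κ) =
      Real.exp (u a θ / κ) / Real.exp (lam θ / κ) := fun a θ => by
    rw [sub_div, Real.exp_sub]
  -- The normalization equation can be solved here: `λ_θ` is `κ` times the logarithm of the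
  -- partition sum.
  have hE : ∀ θ, ∑ b, r b * Real.exp (u b θ / κ) = Real.exp (lam θ / κ) := by
    intro θ
    have h1 := (sum_mul_expR_le_one (α := -1) hκ (fun a => u a θ) hm).2 (hI _)
    rw [hs] at h1
    simp_rw [expR_one] at h1
    change ∑ a, r a * Real.exp ((u a θ - lam θ) / κ) = 1 at h1
    simp_rw [hsplit, ← mul_div_assoc] at h1
    rwa [← Finset.sum_div, div_eq_one_iff_eq (Real.exp_pos _).ne'] at h1
  have hform : (∀ θ, IsQExponential (-1) κ (fun a => u a θ) r (P θ)) ↔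
      ∀ θ a, P θ a = r a * Real.exp (u a θ / κ) / ∑ b, r b * Real.exp (u b θ / κ) := by
    refine forall_congr' fun θ => ?_
    rw [isQExponential_iff hκ _ hm (hP θ), hE, hs]
    have h2 : ∀ a, r a * expR 1 ((u a θ - stateConstant (-1) κ (fun a => u a θ) r) / κ) =
        r a * Real.exp (u a θ / κ) / Real.exp (lam θ / κ) := fun a => by
      rw [expR_one, mul_div_assoc, ← hsplit]
    simp_rw [h2]
    constructor
    · rintro ⟨h3, h4⟩ a
      rcases (hm.1 a).eq_or_lt with h | h
      · rw [(h4 a h.symm).resolve_right fun h' => h'.1 (hI _), ← h]; simp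
      · exact h3 a h
    · intro h3
      exact ⟨fun a _ => h3 a, fun a ha => Or.inl (by rw [h3 a, ha]; simp)⟩
  rw [hform]
  simp only [hhas, true_and]
  refine and_congr_right fun hPf => ?_
  have hdual : ∀ a, dualValue (idx (-1)) κ π u lam a =
      ∑ θ, π θ * (Real.exp (u a θ / κ) / ∑ b, r b * Real.exp (u b θ / κ)) - 1 := by
    intro a
    rw [dualValue, hs]
    simp_rw [genConj, if_neg one_ne_zero, expR_one, Real.rpow_one, div_one, mul_sub]
    rw [Finset.sum_sub_distrib, ← Finset.sum_mul, hπ.2, one_mul]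
    simp_rw [hsplit, hE]
  -- Multiplying by `r a` turns the sum into the marginal `∑ θ, π θ * P θ a`. So on the support the
  -- value is `1` automatically, and the dual condition reduces to `≤ 1` everywhere.
  have hone : ∀ a, 0 < r a →
      ∑ θ, π θ * (Real.exp (u a θ / κ) / ∑ b, r b * Real.exp (u b θ / κ)) = 1 := by
    intro a ha
    refine mul_left_cancel₀ ha.ne' ?_
    rw [mul_one, Finset.mul_sum]
    conv_rhs => rw [hr a]
    refine Finset.sum_congr rfl fun θ _ => ?_
    rw [hPf θ a]
    ring
  have : ∑ a, r a ≠ 0 := by rw [hm.2]; exact one_ne_zero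
  obtain ⟨a₀, -, ha₀⟩ := Finset.exists_ne_zero_of_sum_ne_zero this
  have ha₀ := lt_of_le_of_ne (hm.1 a₀) (Ne.symm ha₀)
  constructor
  · rintro ⟨-, h⟩ b
    have h1 := h a₀ b ha₀
    rw [hdual, hdual, hone a₀ ha₀] at h1
    linarith
  · intro h
    refine ⟨fun _ b θ => ?_, fun a b ha => ?_⟩
    · rw [hs]; exact expQ_one_ne_top _
    · rw [hdual, hdual, hone a ha]
      linarith [h b]

end Main

end AlphaInfo

end

open AlphaInfo in
theorem proposition3 {Θ A : Type*} [Fintype Θ] [Fintype A]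
    (π : Θ → ℝ) (hπ : π ∈ stdSimplex ℝ Θ) (hfull : ∀ θ, 0 < π θ)
    (u : A → Θ → ℝ) (α κ : ℝ) (hκ : 0 < κ)
    (P : Θ → A → ℝ) (hP : IsChoiceRule P)
    (m : A → ℝ) (hm : m = alphaIntegration α π P)
    (lam : Θ → ℝ) (hlam : ∀ θ, lam θ = stateConstant α κ (fun a => u a θ) m) :
    -- the optimality condition
    (IsOptimal α κ π u P ↔
      HasAlphaIntegration α P ∧
      (∀ θ, IsStateSolution α κ (fun a => u a θ) m (P θ)) ∧
      (α ≤ 1 → ∀ a ∈ Function.support m,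
        actionValue α κ π u lam a = ⨆ b, actionValue α κ π u lam b) ∧
      (1 < α → ∀ a ∈ Function.support m,
        actionValue α κ π u lam a = ⨅ b, actionValue α κ π u lam b)) ∧
    -- the explicit form of the first condition
    (HasAlphaIntegration α P → ∀ θ, ∀ p ∈ stdSimplex ℝ A,
      (IsStateSolution α κ (fun a => u a θ) m p ↔
        IsQExponential α κ (fun a => u a θ) m p)) ∧
    -- the case `α = -1`, with the marginal choice probabilities
    (α = -1 → ∀ r : A → ℝ, (∀ a, r a = ∑ θ, π θ * P θ a) →
      (IsOptimal α κ π u P ↔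
        (∀ θ a, P θ a = r a * Real.exp (u a θ / κ) / ∑ b, r b * Real.exp (u b θ / κ)) ∧
        ∀ a, ∑ θ, π θ * (Real.exp (u a θ / κ) / ∑ b, r b * Real.exp (u b θ / κ)) ≤ 1)) := by
  subst hm
  have hΘ := nonempty_of_mem_stdSimplex hπ
  refine ⟨?_, fun h θ p hp => ?_, ?_⟩
  · rw [isOptimal_iff_dualCondition hκ hπ hfull hP hlam]
    refine and_congr_right fun h => ?_
    have hms := alphaIntegration_mem hfull hP h
    refine and_congr (forall_congr' fun θ => (isStateSolution_iff α hκ _ hms (hP θ)).symm) ?_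
    refine (actionValue_condition_iff hπ hfull hms fun a ha θ => ?_).symm
    rw [hlam θ]
    exact expQ_ne_top_of_support hκ (fun a => u a θ) hms (lamBar_le_stateConstant α κ _ _) ha
  · exact isStateSolution_iff α hκ _ (alphaIntegration_mem hfull hP h) hp
  · rintro rfl r hr
    exact isOptimal_neg_one_iff hκ hπ hfull hP hr
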